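/- Let $V$ be a real vector space with $\dim V=3$. Conventions: for $u,v$ in $V$ or in $V^*$, $u\vee v=\tfrac12(u\otimes v+v\otimes u)$ and $u\wedge v=\tfrac12(u\otimes v-v\otimes u)$; for $z\in V$, $z\vee V=\{z\vee v: v\in V\}$ and $z\wedge V=\{z\wedge v: v\in V\}$; for one-forms, $\beta_1\beta_2\beta_3\beta_4=\frac1{4!}\sum_{\sigma\in S_4}\beta_{\sigma(1)}\otimes\beta_{\sigma(2)}\otimes\beta_{\sigma(3)}\otimes\beta_{\sigma(4)}$ (with powers denoting repeated factors). A tensor $S\in (V^*)^{\otimes 4}$ is regarded as a bilinear form on $V\otimes V$ through $S(v_1\otimes v_2,v_3\otimes v_4)=S(v_1,v_2,v_3,v_4)$. Let $$W=\{S\in \mathrm{Sym}^2(\mathrm{Sym}^2V^*)\oplus \mathrm{Sym}^2(\Lambda^2V^*) : S(v_1,v_2,v_3,v_4)=S(v_1,v_4,v_3,v_2)\ \text{for all } v_1,\dots,v_4\in V\},$$ that is, the $S$ which are symmetric bilinear forms on $V\otimes V=\mathrm{Sym}^2V\oplus\Lambda^2V$, for which the two summands are orthogonal, and which have the stated symmetry.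 Let $\mathcal C_W=\{S\in W: S\ge 0\}$ be the cone of positive semi-definite elements, and let $\mathcal C_{\mathrm{Sym}}$ be the cone of positive semi-definite symmetric bilinear forms on $\mathrm{Sym}^2V$. For $S\in W$ let $R(S)$ and $R'(S)$ be the restrictions of $S$ to $\mathrm{Sym}^2V$ and to $\Lambda^2V$. The kernel of a bilinear form $b$ on a space $E$ is the kernel of $b:E\to E^*$, and $\operatorname{rk} b=\dim E-\dim\ker b$. A nonzero element $x$ of a convex cone $\mathcal C$ is extremal if $\mathbb R_{\ge0}x\cap\mathcal C$ is a face of $\mathcal C$, i.e. a convex subset such that every segment in $\mathcal C$ with a relative interior point in the subset has both endpoints in it. (a) A tensor $S$ is an extremal element of $\mathcal C_W$ if and only if it has one of the following three forms: (1) $S=\alpha^4$ for some $\alpha\in V^*\setminus\{0\}$; (2) $S=(\alpha_1\vee\alpha_2)^{\otimes2}+(\alpha_1\wedge\alpha_2)^{\otimes2}$ for some linearly independent $\alpha_1,\alpha_2\in V^*$; (3) for some basis $\{\alpha_1,\alpha_2,\alpha_3\}$ of $V^*$ and some $g,d,h\in\mathbb R$ with $g^2>1-d^2+dh$, $$S=S_{\mathrm{tot}}+2(g^2+d^2-1-dh)\left[(\alpha_2\otimes\alpha_3)^{\otimes2}+(\alpha_3\otimes\alpha_2)^{\otimes2}\right],$$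 where $$\begin{aligned}S_{\mathrm{tot}}={}&\alpha_1^4+6\alpha_1^2\alpha_2^2+6\alpha_1^2\alpha_3^2+12d\,\alpha_1\alpha_2^2\alpha_3+12g\,\alpha_1\alpha_2\alpha_3^2+4h\,\alpha_1\alpha_3^3+(1+d^2)\alpha_2^4\\&+4dg\,\alpha_2^3\alpha_3+6(1+dh)\alpha_2^2\alpha_3^2+4g(d+h)\,\alpha_2\alpha_3^3+(1+g^2+h^2)\alpha_3^4.\end{aligned}$$ Call the following property of a tensor $S\in W$ condition $(\ast)$: $\operatorname{rk}R'(S)=1$, $\operatorname{rk}R(S)=3$, and there is $z\in V\setminus\{0\}$ with $\ker R'(S)=z\wedge V$ and $\ker S\cap(z\vee V)=\{0\}$. (b) A tensor $S$ is of the form (3) if and only if it is an extremal element of $\mathcal C_W$ and satisfies $(\ast)$. (c) If $S\in\mathcal C_W\setminus\{0\}$ and $R(S)$ is not extremal in $\mathcal C_{\mathrm{Sym}}$, then $S$ is extremal in $\mathcal C_W$ if and only if it satisfies $(\ast)$. -/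

import Mathlib

open scoped TensorProduct

noncomputable section

namespace PositivityCone

/-! ### Convexity: faces and extremal elements of a convex cone -/

section Convexity

variable {E : Type*} [AddCommGroup E] [Module ℝ E]

/-- A face of `C`: a convex subset `F ⊆ C` such that every segment in `C` with a relative interior
point in `F` has both endpoints in `F`. -/
def IsFace (C F : Set E) : Prop :=
  Convex ℝ F ∧ IsExtreme ℝ C F

/-- The ray `ℝ_{≥ 0} x`. -/
def ray (x : E) : Set E := {y | ∃ t : ℝ, 0 ≤ t ∧ y = t • x}

/-- `x ∈ C \ {0}` is extremal if it generates an extremal ray of `C`, i.e. `ℝ_{≥ 0} x ∩ C` is a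
face of `C`. -/
def IsExtremal (C : Set E) (x : E) : Prop :=
  x ∈ C ∧ x ≠ 0 ∧ IsFace C (ray x ∩ C)

end Convexity

/-- The rank of a (symmetric) bilinear form: the dimension of the space minus the dimension of the
kernel of `b : E → E*`. -/
def formRank {E : Type*} [AddCommGroup E] [Module ℝ E] (b : LinearMap.BilinForm ℝ E) : ℕ :=
  Module.finrank ℝ E - Module.finrank ℝ (LinearMap.ker b)

section Tensors

variable (V : Type*) [AddCommGroup V] [Module ℝ V]

/-- `Sym² V` as the subspace of symmetric tensors in `V ⊗ V`. -/
def SymSq : Submodule ℝ (V ⊗[ℝ] V) :=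
  LinearMap.ker ((TensorProduct.comm ℝ V V).toLinearMap - LinearMap.id)

/-- `Λ² V` as the subspace of antisymmetric tensors in `V ⊗ V`. -/
def AltSq : Submodule ℝ (V ⊗[ℝ] V) :=
  LinearMap.ker ((TensorProduct.comm ℝ V V).toLinearMap + LinearMap.id)

/-- The space `W` of all `S ∈ Sym²(Sym² V*) ⊕ Sym²(Λ² V*)` with `τ S = S`, where a four-tensor `S`
on `V` is regarded as a bilinear form on `V ⊗ V` through
`S(v₁, v₂, v₃, v₄) = S(v₁ ⊗ v₂, v₃ ⊗ v₄)`. That is, `S` is symmetric, makes `Sym² V` and `Λ² V`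
orthogonal, and satisfies `S(v₁, v₂, v₃, v₄) = S(v₁, v₄, v₃, v₂)`. -/
def W : Submodule ℝ (LinearMap.BilinForm ℝ (V ⊗[ℝ] V)) where
  carrier := {S | (∀ s t, S s t = S t s) ∧ (∀ s ∈ SymSq V, ∀ t ∈ AltSq V, S s t = 0) ∧
    ∀ v₁ v₂ v₃ v₄ : V, S (v₁ ⊗ₜ v₂) (v₃ ⊗ₜ v₄) = S (v₁ ⊗ₜ v₄) (v₃ ⊗ₜ v₂)}
  zero_mem' := by simp
  add_mem' := by
    rintro S T ⟨hS1, hS2, hS3⟩ ⟨hT1, hT2, hT3⟩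
    refine ⟨fun s t => ?_, fun s hs t ht => ?_, fun v₁ v₂ v₃ v₄ => ?_⟩
    · simp only [LinearMap.add_apply, hS1 s t, hT1 s t]
    · simp only [LinearMap.add_apply, hS2 s hs t ht, hT2 s hs t ht, add_zero]
    · simp only [LinearMap.add_apply, hS3 v₁ v₂ v₃ v₄, hT3 v₁ v₂ v₃ v₄]
  smul_mem' := by
    rintro c S ⟨hS1, hS2, hS3⟩
    refine ⟨fun s t => ?_, fun s hs t ht => ?_, fun v₁ v₂ v₃ v₄ => ?_⟩
    · simp only [LinearMap.smul_apply, hS1 s t]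
    · simp only [LinearMap.smul_apply, hS2 s hs t ht, smul_zero]
    · simp only [LinearMap.smul_apply, hS3 v₁ v₂ v₃ v₄]

/-- The spectrahedral cone `C_W` of positive semi-definite elements of `W`. -/
def CW : Set (LinearMap.BilinForm ℝ (V ⊗[ℝ] V)) :=
  {S | S ∈ W V ∧ ∀ t, 0 ≤ S t t}

/-- The cone `C_Sym` of positive semi-definite symmetric bilinear forms on `Sym² V`. -/
def CSym : Set (LinearMap.BilinForm ℝ (SymSq V)) :=
  {T | (∀ s t, T s t = T t s) ∧ ∀ t, 0 ≤ T t t}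

variable {V}

/-- `R(S)`, the restriction of `S` to `Sym² V`. -/
def R (S : LinearMap.BilinForm ℝ (V ⊗[ℝ] V)) : LinearMap.BilinForm ℝ (SymSq V) :=
  LinearMap.BilinForm.restrict S (SymSq V)

/-- `R'(S)`, the restriction of `S` to `Λ² V`. -/
def R' (S : LinearMap.BilinForm ℝ (V ⊗[ℝ] V)) : LinearMap.BilinForm ℝ (AltSq V) :=
  LinearMap.BilinForm.restrict S (AltSq V)

/-- `z ∨ V = {z ∨ v : v ∈ V}`, where `z ∨ v = (z ⊗ v + v ⊗ z) / 2`. -/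
def veeSpace (z : V) : Submodule ℝ (V ⊗[ℝ] V) :=
  LinearMap.range
    ((1 / 2 : ℝ) • (TensorProduct.mk ℝ V V z + (TensorProduct.mk ℝ V V).flip z))

/-- `z ∧ V = {z ∧ v : v ∈ V}`, where `z ∧ v = (z ⊗ v - v ⊗ z) / 2`. -/
def wedgeSpace (z : V) : Submodule ℝ (V ⊗[ℝ] V) :=
  LinearMap.range
    ((1 / 2 : ℝ) • (TensorProduct.mk ℝ V V z - (TensorProduct.mk ℝ V V).flip z))

/-- `rk R'(S) = 1`, `rk R(S) = 3`, and `ker S ∩ (z ∨ V) = 0`, where `z ≠ 0` is such that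
`ker R'(S) = z ∧ V`. -/
def HasInelasticRanks (S : LinearMap.BilinForm ℝ (V ⊗[ℝ] V)) : Prop :=
  formRank (R' S) = 1 ∧ formRank (R S) = 3 ∧
    ∃ z : V, z ≠ 0 ∧ (LinearMap.ker (R' S)).map (AltSq V).subtype = wedgeSpace z ∧
      LinearMap.ker S ⊓ veeSpace z = ⊥

end Tensors

section Forms

variable {V : Type*} [AddCommGroup V] [Module ℝ V]

/-- `α ⊗ β ∈ V* ⊗ V*`, as the linear form `v ⊗ w ↦ α(v) β(w)` on `V ⊗ V`. -/
def tensor (α β : Module.Dual ℝ V) : Module.Dual ℝ (V ⊗[ℝ] V) :=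
  TensorProduct.dualDistrib ℝ V V (α ⊗ₜ[ℝ] β)

/-- `α ∨ β = (α ⊗ β + β ⊗ α) / 2`. -/
def vee (α β : Module.Dual ℝ V) : Module.Dual ℝ (V ⊗[ℝ] V) :=
  (1 / 2 : ℝ) • (tensor α β + tensor β α)

/-- `α ∧ β = (α ⊗ β - β ⊗ α) / 2`. -/
def wedge (α β : Module.Dual ℝ V) : Module.Dual ℝ (V ⊗[ℝ] V) :=
  (1 / 2 : ℝ) • (tensor α β - tensor β α)

/-- `φ^{⊗ 2}` for `φ ∈ V* ⊗ V*`, as the bilinear form `(s, t) ↦ φ(s) φ(t)`. -/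
def tensorSq (φ : Module.Dual ℝ (V ⊗[ℝ] V)) : LinearMap.BilinForm ℝ (V ⊗[ℝ] V) :=
  LinearMap.BilinForm.linMulLin φ φ

/-- The totally symmetric product
`β₁β₂β₃β₄ = (1/4!) ∑_σ β_{σ(1)} ⊗ β_{σ(2)} ⊗ β_{σ(3)} ⊗ β_{σ(4)}` of four one-forms. -/
def symProd (β₁ β₂ β₃ β₄ : Module.Dual ℝ V) : LinearMap.BilinForm ℝ (V ⊗[ℝ] V) :=
  (1 / 24 : ℝ) • ∑ σ : Equiv.Perm (Fin 4),
    LinearMap.BilinForm.linMulLin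
      (tensor (![β₁, β₂, β₃, β₄] (σ 0)) (![β₁, β₂, β₃, β₄] (σ 1)))
      (tensor (![β₁, β₂, β₃, β₄] (σ 2)) (![β₁, β₂, β₃, β₄] (σ 3)))

/-- The totally symmetric tensor `S_tot` in the third family. -/
def Stot (α₁ α₂ α₃ : Module.Dual ℝ V) (g d h : ℝ) : LinearMap.BilinForm ℝ (V ⊗[ℝ] V) :=
  symProd α₁ α₁ α₁ α₁ + (6 : ℝ) • symProd α₁ α₁ α₂ α₂ + (6 : ℝ) • symProd α₁ α₁ α₃ α₃
    + (12 * d) • symProd α₁ α₂ α₂ α₃ + (12 * g) • symProd α₁ α₂ α₃ α₃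
    + (4 * h) • symProd α₁ α₃ α₃ α₃ + (1 + d ^ 2) • symProd α₂ α₂ α₂ α₂
    + (4 * d * g) • symProd α₂ α₂ α₂ α₃ + (6 * (1 + d * h)) • symProd α₂ α₂ α₃ α₃
    + (4 * g * (d + h)) • symProd α₂ α₃ α₃ α₃
    + (1 + g ^ 2 + h ^ 2) • symProd α₃ α₃ α₃ α₃

/-- Type (1): `S = α⁴` with `α ≠ 0`. -/
def IsType1 (S : LinearMap.BilinForm ℝ (V ⊗[ℝ] V)) : Prop :=
  ∃ α : Module.Dual ℝ V, α ≠ 0 ∧ S = symProd α α α α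

/-- Type (2): `S = (α₁ ∨ α₂)^{⊗ 2} + (α₁ ∧ α₂)^{⊗ 2}` with `α₁, α₂` linearly independent. -/
def IsType2 (S : LinearMap.BilinForm ℝ (V ⊗[ℝ] V)) : Prop :=
  ∃ α₁ α₂ : Module.Dual ℝ V, LinearIndependent ℝ ![α₁, α₂] ∧
    S = tensorSq (vee α₁ α₂) + tensorSq (wedge α₁ α₂)

/-- Type (3): the three-parameter family, in some basis of `V*`. -/
def IsType3 (S : LinearMap.BilinForm ℝ (V ⊗[ℝ] V)) : Prop :=
  ∃ (α : Module.Basis (Fin 3) ℝ (Module.Dual ℝ V)) (g d h : ℝ),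
    1 - d ^ 2 + d * h < g ^ 2 ∧
    S = Stot (α 0) (α 1) (α 2) g d h
      + (2 * (g ^ 2 + d ^ 2 - 1 - d * h)) •
        (tensorSq (tensor (α 1) (α 2)) + tensorSq (tensor (α 2) (α 1)))

end Forms

end PositivityCone

end

/-!
A tensor `S` in `W` is determined by its restriction `H = symPart S` to `Sym² V`, and `H` can be any
symmetric form there: the exchange of the second and the fourth argument forces the restriction
`altForm H` to `Λ² V`. Hence `C_W` is the set of all `H ≥ 0` with `altForm H ≥ 0`, where
`altForm H (x ∧ y, x ∧ y) = H (x ∨ y, x ∨ y) - H (x ∨ x, y ∨ y)`. As for every spectrahedral cone, `S`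
is extremal if and only if its multiples are the only elements of `W` that vanish on its kernel
(`isExtremal_of_forall`, `IsExtremal.exists_smul_eq`). For `H` this kernel condition bears on both
blocks (`IsSymForm.exists_smul_eq`).

If `H` has rank one, it is the square of a quadratic form with nonpositive `2 × 2` principal minors
in every basis. Such a form is a product of two linear forms up to sign, which gives the types (1)
and (2) (`IsSymForm.isType1_or_isType2`). Let `S` be extremal and let `H` have rank at least two.
* A dimension count bounds the rank of `H` by three (`IsSymForm.rank_le_three`).
* The alternating block has rank at most one, so that `z ∧ V` is in its kernel for some `z ≠ 0`
  (`IsSymForm.exists_forall_altForm_eq_zero`). This is a dimension count again, except when `H` has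
  rank two and the alternating block too. Then `H` is a degenerate Hankel form on the symmetric
  square of a plane, and a suitable basis of the plane diagonalises it
  (`IsSymForm.exists_pair_apply_eq_zero`).
* The form `H` is nondegenerate on `z ∨ V`: otherwise a part of `H` splits off orthogonally
  (`IsSymForm.eq_zero_of_apply_tmul_eq_zero`). In particular `H` has rank three.

Now `H (z ∨ x, y ∨ w)` is a cubic form `c`. Its contraction with `z` is a scalar product on `V`, and
`H` is the Gram form of the vectors `c (x, y, ·)`. In an orthonormal basis that begins with a
multiple of `z` and is rotated such that `c₁₁₁ = 0`, the remaining coefficients of `c` are `d`, `g`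
and `h` (`IsAdapted.isType3`). The number `κ = g² + d² - 1 - dh` measures both the alternating block
and the commutator of the operators `c (x, ·, ·)`. If `κ = 0`, these operators commute, and `c` then
yields a further element of `W` that vanishes on the kernel (`IsAdapted.altForm_ne_zero`). If
`κ > 0`, the same symmetry conditions have only the multiples of `S` as solutions
(`isExtremal_netForm`). Condition `(∗)` is what the construction of the basis needs
(`HasInelasticRanks.isType3`), and it holds in such a basis (`IsAdapted.hasInelasticRanks`).
-/

namespace PositivityCone

/-! ### Positive semi-definite forms -/

section Semidefinite

variable {E : Type*} [AddCommGroup E] [Module ℝ E]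

lemma apply_eq_zero_of_self {S : LinearMap.BilinForm ℝ E} (hs : ∀ s t, S s t = S t s)
    (hp : ∀ t, 0 ≤ S t t) {x : E} (hx : S x x = 0) : S x = 0 := by
  ext y
  have h := LinearMap.BilinForm.apply_sq_le_of_symm S hp ⟨hs⟩ x y
  rw [hx, zero_mul] at h
  simpa using pow_eq_zero_iff (two_ne_zero) |>.1 (le_antisymm h (sq_nonneg _))

lemma eq_zero_of_forall_self {S : LinearMap.BilinForm ℝ E} (hs : ∀ s t, S s t = S t s)
    (hp : ∀ t, S t t = 0) : S = 0 := by
  refine LinearMap.ext fun x => ?_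
  exact apply_eq_zero_of_self hs (fun t => (hp t).ge) (hp x)

/-- Diagonalisation of a positive semi-definite form. The number `n` is the rank of the form. -/
lemma exists_orthonormal_expansion [FiniteDimensional ℝ E] {S : LinearMap.BilinForm ℝ E}
    (hs : ∀ s t, S s t = S t s) (hp : ∀ t, 0 ≤ S t t) :
    ∃ (n : ℕ) (v : Fin n → E), (∀ i j, S (v i) (v j) = if i = j then 1 else 0) ∧
      ∀ x y, S x y = ∑ i, S x (v i) * S y (v i) := by
  classical
  obtain ⟨w, hw⟩ := LinearMap.BilinForm.exists_orthogonal_basis (B := S) ⟨hs⟩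
  have hw' : ∀ i j, i ≠ j → S (w i) (w j) = 0 := fun i j hij => hw hij
  let e := (Fintype.equivFin {i // S (w i) (w i) ≠ 0}).symm
  let r : {i // S (w i) (w i) ≠ 0} → ℝ := fun k => (Real.sqrt (S (w k) (w k)))⁻¹
  have hr : ∀ k, r k * r k * S (w k) (w k) = 1 := by
    rintro ⟨k, hk⟩
    have h0 := hp (w k)
    have h1 := Real.mul_self_sqrt h0
    have h2 : Real.sqrt (S (w k) (w k)) ≠ 0 := by
      intro h; rw [h] at h1; exact hk (by linarith)
    simp only [r]
    rw [← mul_inv, h1, inv_mul_cancel₀ hk]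
  refine ⟨_, fun i => r (e i) • w (e i), fun i j => ?_, fun x y => ?_⟩
  · simp only [map_smul, LinearMap.smul_apply, smul_eq_mul]
    split_ifs with h
    · subst h; rw [← hr (e i)]; ring
    · rw [hw' _ _ (fun h' => h (e.injective (Subtype.ext h')))]; ring
  · have hsum : S = ∑ k : {i // S (w i) (w i) ≠ 0},
        LinearMap.BilinForm.linMulLin (r k • S (w k)) (r k • S (w k)) := by
      refine w.ext fun i => w.ext fun j => ?_
      simp only [LinearMap.sum_apply, LinearMap.BilinForm.linMulLin_apply, LinearMap.smul_apply,
        smul_eq_mul]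
      by_cases hi : S (w i) (w i) = 0
      · rw [apply_eq_zero_of_self hs hp hi, LinearMap.zero_apply, Finset.sum_eq_zero]
        intro k _
        rw [hw' k i (fun h => k.2 (h ▸ hi))]; ring
      · rw [Finset.sum_eq_single ⟨i, hi⟩]
        · have := hr ⟨i, hi⟩
          simp only at this ⊢
          linear_combination (-S (w i) (w j)) * this
        · intro k _ hk
          rw [hw' k i (fun h => hk (Subtype.ext h))]; ring
        · simp
    conv_lhs => rw [hsum]
    rw [← Equiv.sum_comp e]
    simp only [LinearMap.sum_apply, LinearMap.BilinForm.linMulLin_apply, LinearMap.smul_apply,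
        smul_eq_mul, map_smul]
    refine Finset.sum_congr rfl fun i _ => ?_
    rw [hs x, hs y]

/-- The rank of a form is the number of vectors in an orthonormal expansion. -/
lemma formRank_eq_of_expansion [FiniteDimensional ℝ E] {S : LinearMap.BilinForm ℝ E}
    {n : ℕ} {v : Fin n → E} (hv : ∀ i j, S (v i) (v j) = if i = j then 1 else 0)
    (he : ∀ x y, S x y = ∑ i, S x (v i) * S y (v i)) : formRank S = n := by
  classical
  let f : E →ₗ[ℝ] (Fin n → ℝ) := LinearMap.pi fun i => S.flip (v i)
  have hf : ∀ x i, f x i = S x (v i) := fun x i => rfl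
  have hker : LinearMap.ker f = LinearMap.ker S := by
    ext x
    simp only [LinearMap.mem_ker]
    constructor
    · intro h
      ext y
      rw [he, LinearMap.zero_apply]
      exact Finset.sum_eq_zero fun i _ => by rw [← hf, h]; simp
    · intro h
      ext i
      rw [hf, h]; rfl
  have hsurj : Function.Surjective f := by
    intro c
    refine ⟨∑ i, c i • v i, ?_⟩
    ext j
    rw [hf]
    simp [hv]
  have h := LinearMap.finrank_range_add_finrank_ker f
  rw [LinearMap.range_eq_top.2 hsurj, finrank_top, hker] at h
  simp only [Module.finrank_fintype_fun_eq_card, Fintype.card_fin] at h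
  unfold formRank
  omega

/-- A symmetric form whose kernel contains that of a positive semi-definite form `S` can be added
to `S` and subtracted from it, once scaled down, without leaving the semi-definite cone. -/
lemma exists_pos_mul_abs_le [FiniteDimensional ℝ E] {S T : LinearMap.BilinForm ℝ E}
    (hs : ∀ s t, S s t = S t s) (hp : ∀ t, 0 ≤ S t t) (ht : ∀ s t, T s t = T t s)
    (hk : ∀ t, S t = 0 → T t = 0) : ∃ ε : ℝ, 0 < ε ∧ ∀ t, ε * |T t t| ≤ S t t := by
  obtain ⟨n, v, hv, he⟩ := exists_orthonormal_expansion hs hp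
  have hT : ∀ x y, T x y = ∑ i, S x (v i) * T (v i) y := by
    intro x y
    have h1 : S (x - ∑ i, S x (v i) • v i) = 0 := by
      ext y
      simp [he x y, hs _ y]
    have h2 := LinearMap.congr_fun (hk _ h1) y
    simp only [map_sub, map_sum, map_smul, LinearMap.sub_apply, LinearMap.sum_apply,
      LinearMap.smul_apply, smul_eq_mul, LinearMap.zero_apply] at h2
    linarith
  set C := ∑ i, ∑ j, |T (v i) (v j)| with hC
  have hC0 : 0 ≤ C := Finset.sum_nonneg fun i _ => Finset.sum_nonneg fun j _ => abs_nonneg _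
  refine ⟨1 / (C + 1), by positivity, fun x => ?_⟩
  have hb : |T x x| ≤ C * S x x := by
    have h3 : T x x = ∑ i, ∑ j, S x (v i) * (S x (v j) * T (v j) (v i)) := by
      rw [hT x x]
      refine Finset.sum_congr rfl fun i _ => ?_
      rw [ht, hT, Finset.mul_sum]
    have hsq : ∀ i, S x (v i) ^ 2 ≤ S x x := by
      intro i
      rw [he x x]
      refine le_trans (le_of_eq (sq _)) (Finset.single_le_sum (f := fun i => S x (v i) * S x (v i))
        (fun j _ => mul_self_nonneg _) (Finset.mem_univ i))
    rw [h3, hC, Finset.sum_mul]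
    refine (Finset.abs_sum_le_sum_abs _ _).trans (Finset.sum_le_sum fun i _ => ?_)
    rw [Finset.sum_mul]
    refine (Finset.abs_sum_le_sum_abs _ _).trans (Finset.sum_le_sum fun j _ => ?_)
    rw [← mul_assoc, abs_mul, ht (v j), mul_comm]
    refine mul_le_mul_of_nonneg_left ?_ (abs_nonneg _)
    rw [abs_le]
    constructor <;> nlinarith [hsq i, hsq j, sq_nonneg (S x (v i) + S x (v j)),
      sq_nonneg (S x (v i) - S x (v j))]
  rw [div_mul_eq_mul_div, one_mul, div_le_iff₀ (by positivity)]
  nlinarith [hp x]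

end Semidefinite

/-! ### Extremal elements of spectrahedral cones -/

section Extremal

variable {E : Type*} [AddCommGroup E] [Module ℝ E]

/-- In the cone of positive semi-definite elements of a linear space `M` of symmetric forms, an
element is extremal as soon as its multiples are the only elements of `M` that vanish on its
kernel. -/
lemma isExtremal_of_forall {M : Submodule ℝ (LinearMap.BilinForm ℝ E)}
    {C : Set (LinearMap.BilinForm ℝ E)} (hC : ∀ T, T ∈ C ↔ T ∈ M ∧ ∀ t, 0 ≤ T t t)
    (hM : ∀ T ∈ M, ∀ s t, T s t = T t s) {S : LinearMap.BilinForm ℝ E} (hS : S ∈ C)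
    (hS0 : S ≠ 0) (h : ∀ T ∈ M, (∀ t, S t = 0 → T t = 0) → ∃ c : ℝ, T = c • S) :
    IsExtremal C S := by
  obtain ⟨hSM, hSp⟩ := (hC S).1 hS
  have hconv : Convex ℝ C := by
    intro X hX Y hY a b ha hb _
    rw [hC] at hX hY ⊢
    refine ⟨M.add_mem (M.smul_mem _ hX.1) (M.smul_mem _ hY.1), fun t => ?_⟩
    have := hX.2 t
    have := hY.2 t
    simp only [LinearMap.add_apply, LinearMap.smul_apply, smul_eq_mul]
    positivity
  have hray : Convex ℝ (ray S) := by
    rintro _ ⟨x, hx, rfl⟩ _ ⟨y, hy, rfl⟩ a b ha hb _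
    exact ⟨a * x + b * y, by positivity, by rw [add_smul, mul_smul, mul_smul]⟩
  refine ⟨hS, hS0, hray.inter hconv, Set.inter_subset_right, ?_⟩
  rintro X hX Y hY _ ⟨⟨c, hc, rfl⟩, -⟩ ⟨a, b, ha, hb, -, hab⟩
  refine ⟨?_, hX⟩
  obtain ⟨hXM, hXp⟩ := (hC X).1 hX
  obtain ⟨hYM, hYp⟩ := (hC Y).1 hY
  have hker : ∀ t, S t t = 0 → X t t = 0 := by
    intro t ht
    have h1 : a * X t t + b * Y t t = c * S t t := by
      simpa using LinearMap.congr_fun (LinearMap.congr_fun hab t) t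
    rw [ht, mul_zero] at h1
    have h2 := mul_nonneg hb.le (hYp t)
    have h3 : a * X t t = 0 := le_antisymm (by linarith) (mul_nonneg ha.le (hXp t))
    exact (mul_eq_zero.1 h3).resolve_left ha.ne'
  obtain ⟨k, rfl⟩ := h X hXM fun t ht =>
    apply_eq_zero_of_self (hM X hXM) hXp (hker t (by rw [ht]; rfl))
  obtain ⟨t, ht⟩ : ∃ t, S t t ≠ 0 := by
    by_contra! hcon
    exact hS0 (eq_zero_of_forall_self (hM S hSM) hcon)
  refine ⟨k, ?_, rfl⟩
  have h1 := hXp t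
  simp only [LinearMap.smul_apply, smul_eq_mul] at h1
  exact nonneg_of_mul_nonneg_left h1 (lt_of_le_of_ne (hSp t) ht.symm)

lemma IsExtremal.exists_smul_eq [FiniteDimensional ℝ E]
    {M : Submodule ℝ (LinearMap.BilinForm ℝ E)}
    {C : Set (LinearMap.BilinForm ℝ E)} (hC : ∀ T, T ∈ C ↔ T ∈ M ∧ ∀ t, 0 ≤ T t t)
    (hM : ∀ T ∈ M, ∀ s t, T s t = T t s) {S : LinearMap.BilinForm ℝ E} (hS : IsExtremal C S)
    {T : LinearMap.BilinForm ℝ E} (hT : T ∈ M) (hk : ∀ t, S t = 0 → T t = 0) :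
    ∃ c : ℝ, T = c • S := by
  obtain ⟨hSC, hS0, -, -, hF⟩ := hS
  obtain ⟨hSM, hSp⟩ := (hC S).1 hSC
  obtain ⟨ε, hε, hle⟩ := exists_pos_mul_abs_le (hM S hSM) hSp (hM T hT) hk
  have h1 : S + ε • T ∈ C := (hC _).2 ⟨M.add_mem hSM (M.smul_mem _ hT), fun t => by
    have := neg_abs_le (T t t)
    have := hle t
    simp only [LinearMap.add_apply, LinearMap.smul_apply, smul_eq_mul]
    nlinarith⟩
  have h2 : S + (-ε) • T ∈ C := (hC _).2 ⟨M.add_mem hSM (M.smul_mem _ hT), fun t => by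
    have := le_abs_self (T t t)
    have := hle t
    simp only [LinearMap.add_apply, LinearMap.smul_apply, smul_eq_mul]
    nlinarith⟩
  obtain ⟨⟨c, -, hc⟩, -⟩ := hF h1 h2 (z := S) ⟨⟨1, zero_le_one, (one_smul _ _).symm⟩, hSC⟩
    ⟨1 / 2, 1 / 2, by norm_num, by norm_num, by norm_num, by module⟩
  refine ⟨ε⁻¹ * (c - 1), LinearMap.ext fun s => LinearMap.ext fun t => ?_⟩
  have h3 := LinearMap.congr_fun (LinearMap.congr_fun hc s) t
  simp only [LinearMap.add_apply, LinearMap.smul_apply, smul_eq_mul] at h3 ⊢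
  field_simp
  linarith

end Extremal

/-! ### Forms in the span of the squares of `H` -/

section Families

variable {E : Type*} [AddCommGroup E] [Module ℝ E]

/-- The form `∑ aᵢⱼ H(vᵢ, ·) H(vⱼ, ·)`. -/
noncomputable def spanForm (H : LinearMap.BilinForm ℝ E) {n : ℕ} (v : Fin n → E)
    (a : Fin n → Fin n → ℝ) : LinearMap.BilinForm ℝ E :=
  ∑ i, ∑ j, a i j • LinearMap.BilinForm.linMulLin (H (v i)) (H (v j))

lemma spanForm_apply (H : LinearMap.BilinForm ℝ E) {n : ℕ} (v : Fin n → E)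
    (a : Fin n → Fin n → ℝ) (s t : E) :
    spanForm H v a s t = ∑ i, ∑ j, a i j * (H (v i) s * H (v j) t) := by
  simp [spanForm, LinearMap.sum_apply]

/-- Dimension count: the symmetric forms `∑ aᵢⱼ H(vᵢ, ·) H(vⱼ, ·)` make up a space of dimension
`n (n + 1) / 2`, so that `m` linear conditions leave a form which is not a multiple of `H` when
`m + 1 < n (n + 1) / 2`. -/
lemma exists_spanForm {H : LinearMap.BilinForm ℝ E} {n m : ℕ}
    {v : Fin n → E} (hv : ∀ i j, H (v i) (v j) = if i = j then 1 else 0)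
    {L : LinearMap.BilinForm ℝ E → Fin m → ℝ} (hL : IsLinearMap ℝ L)
    (hm : m + 1 < n * (n + 1) / 2) :
    ∃ a : Fin n → Fin n → ℝ, (∀ i j, a i j = a j i) ∧ L (spanForm H v a) = 0 ∧
      ∀ c : ℝ, spanForm H v a ≠ c • H := by
  classical
  have hn : 0 < n := by rcases n with _ | n <;> simp_all
  let i₀ : Fin n := ⟨0, hn⟩
  -- symmetric coefficient matrices are functions on unordered pairs
  let F : (Sym2 (Fin n) → ℝ) →ₗ[ℝ] LinearMap.BilinForm ℝ E :=
    ∑ i, ∑ j, (LinearMap.proj s(i, j)).smulRight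
      (LinearMap.BilinForm.linMulLin (H (v i)) (H (v j)))
  have hF : ∀ a, F a = spanForm H v fun i j => a s(i, j) := by
    intro a
    simp [F, spanForm, LinearMap.sum_apply]
  -- one more condition, which multiples of `H` do not satisfy, excludes them
  let G : (Sym2 (Fin n) → ℝ) →ₗ[ℝ] (Fin m → ℝ) × ℝ :=
    (hL.mk' L ∘ₗ F).prod (LinearMap.proj s(i₀, i₀))
  have hcard : Module.finrank ℝ ((Fin m → ℝ) × ℝ) < Module.finrank ℝ (Sym2 (Fin n) → ℝ) := by
    rw [Module.finrank_prod, Module.finrank_fintype_fun_eq_card, Module.finrank_fintype_fun_eq_card,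
      Sym2.card, Fintype.card_fin, Fintype.card_fin, Module.finrank_self,
      Nat.choose_two_right]
    rw [mul_comm] at hm
    simpa using hm
  have hker := LinearMap.ker_ne_bot_of_finrank_lt (f := G) hcard
  obtain ⟨a, ha, ha0⟩ := (Submodule.ne_bot_iff _).1 hker
  rw [LinearMap.mem_ker] at ha
  have hval : ∀ i j, spanForm H v (fun i j => a s(i, j)) (v i) (v j) = a s(i, j) := by
    intro i j
    rw [spanForm_apply]
    simp [hv]
  refine ⟨fun i j => a s(i, j), fun i j => congrArg a Sym2.eq_swap, ?_, ?_⟩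
  · rw [← hF]
    exact congrArg Prod.fst ha
  · intro c hc
    have h1 : a s(i₀, i₀) = 0 := congrArg Prod.snd ha
    have h2 : a s(i₀, i₀) = c := by
      rw [← hval, hc]
      simp [hv]
    rw [h1] at h2
    apply ha0
    ext p
    induction p using Sym2.ind with
    | _ i j =>
      rw [← hval, hc, ← h2]
      simp

/-- The part of a positive semi-definite form `H` carried by a subspace `Q`: the pull-back of `H`
under the `H`-orthogonal projection to `Q`. -/
lemma exists_projection [FiniteDimensional ℝ E] {H : LinearMap.BilinForm ℝ E}
    (hs : ∀ s t, H s t = H t s) (hp : ∀ t, 0 ≤ H t t) (Q : Submodule ℝ E) :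
    ∃ (n : ℕ) (v : Fin n → E) (a : Fin n → Fin n → ℝ), (∀ i j, a i j = a j i) ∧
      (∀ u ∈ Q, spanForm H v a u = H u) ∧
      ∀ p, (∀ u ∈ Q, H p u = 0) → spanForm H v a p = 0 := by
  classical
  obtain ⟨n, v, hv, he⟩ := exists_orthonormal_expansion (S := LinearMap.BilinForm.restrict H Q)
    (fun s t => hs _ _) (fun t => hp _)
  have hv' : ∀ i j, H (v i) (v j) = if i = j then 1 else 0 := hv
  have he' : ∀ x y : Q, H x y = ∑ i, H x (v i) * H y (v i) := he
  refine ⟨n, fun i => v i, fun i j => if i = j then 1 else 0, fun i j => by simp [eq_comm],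
    fun u hu => ?_, fun p hpq => ?_⟩
  · have h0 : H (u - ∑ i, H u (v i) • (v i : E)) = 0 := by
      refine apply_eq_zero_of_self hs hp ?_
      have h1 := he' ⟨u, hu⟩ ⟨u, hu⟩
      simp only at h1
      simp [hv', hs _ u, h1]
    ext t
    rw [spanForm_apply]
    have h2 := LinearMap.congr_fun h0 t
    simp only [map_sub, map_sum, map_smul, LinearMap.sub_apply, LinearMap.sum_apply,
      LinearMap.smul_apply, smul_eq_mul, LinearMap.zero_apply] at h2
    simp only [ite_mul, one_mul, zero_mul, Finset.sum_ite_eq, Finset.mem_univ, if_true]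
    rw [sub_eq_zero.1 h2]
    exact Finset.sum_congr rfl fun i _ => by rw [hs u]
  · ext t
    rw [spanForm_apply]
    simp [hs _ p, hpq _ (v _).2]

end Families

/-! ### Tensors in `W` and their restrictions to `Sym² V` -/

section SymmetricPart

variable {V : Type*} [AddCommGroup V] [Module ℝ V]

/-- A symmetric bilinear form on `Sym² V`, encoded as a form on `V ⊗ V` that vanishes on `Λ² V`. -/
def IsSymForm (H : LinearMap.BilinForm ℝ (V ⊗[ℝ] V)) : Prop :=
  (∀ s t, H s t = H t s) ∧ ∀ x y : V, H (x ⊗ₜ y) = H (y ⊗ₜ x)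

/-- The form on `Λ² V` attached to a form `H` on `Sym² V`: the only one whose sum with `H` is
invariant under the exchange of the second and the fourth argument. -/
noncomputable def altForm (H : LinearMap.BilinForm ℝ (V ⊗[ℝ] V)) :
    LinearMap.BilinForm ℝ (V ⊗[ℝ] V) :=
  (TensorProduct.mk ℝ (V ⊗[ℝ] V) (V ⊗[ℝ] V)).compr₂
    (TensorProduct.lift H ∘ₗ (TensorProduct.tensorTensorTensorComm ℝ V V V V).toLinearMap ∘ₗ
        TensorProduct.map LinearMap.id (TensorProduct.comm ℝ V V).toLinearMap -
      TensorProduct.lift H ∘ₗ (TensorProduct.tensorTensorTensorComm ℝ V V V V).toLinearMap)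

/-- The element of `W` whose restriction to `Sym² V` is `H`. -/
noncomputable def liftForm (H : LinearMap.BilinForm ℝ (V ⊗[ℝ] V)) :
    LinearMap.BilinForm ℝ (V ⊗[ℝ] V) :=
  H + altForm H

/-- The restriction of `S` to `Sym² V`, extended by zero on `Λ² V`. -/
noncomputable def symPart (S : LinearMap.BilinForm ℝ (V ⊗[ℝ] V)) :
    LinearMap.BilinForm ℝ (V ⊗[ℝ] V) :=
  (1 / 2 : ℝ) • (S + S ∘ₗ (TensorProduct.comm ℝ V V).toLinearMap)

lemma altForm_tmul (H : LinearMap.BilinForm ℝ (V ⊗[ℝ] V)) (x y z w : V) :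
    altForm H (x ⊗ₜ y) (z ⊗ₜ w) = H (x ⊗ₜ w) (y ⊗ₜ z) - H (x ⊗ₜ z) (y ⊗ₜ w) := by
  simp [altForm]

lemma liftForm_tmul (H : LinearMap.BilinForm ℝ (V ⊗[ℝ] V)) (x y z w : V) :
    liftForm H (x ⊗ₜ y) (z ⊗ₜ w) =
      H (x ⊗ₜ y) (z ⊗ₜ w) + (H (x ⊗ₜ w) (y ⊗ₜ z) - H (x ⊗ₜ z) (y ⊗ₜ w)) := by
  simp [liftForm, altForm_tmul]

lemma symPart_tmul (S : LinearMap.BilinForm ℝ (V ⊗[ℝ] V)) (x y : V) (t : V ⊗[ℝ] V) :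
    symPart S (x ⊗ₜ y) t = (1 / 2) * (S (x ⊗ₜ y) t + S (y ⊗ₜ x) t) := by
  simp [symPart, mul_add]

/-- Two forms on `V ⊗ V` agree if they agree on pure tensors. -/
lemma form_ext {S T : LinearMap.BilinForm ℝ (V ⊗[ℝ] V)}
    (h : ∀ x y z w : V, S (x ⊗ₜ y) (z ⊗ₜ w) = T (x ⊗ₜ y) (z ⊗ₜ w)) : S = T := by
  refine TensorProduct.ext' fun x y => TensorProduct.ext' fun z w => h x y z w

lemma form_ext_left {f g : V ⊗[ℝ] V →ₗ[ℝ] ℝ} (h : ∀ z w : V, f (z ⊗ₜ w) = g (z ⊗ₜ w)) :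
    f = g :=
  TensorProduct.ext' h

lemma form_symm {S : LinearMap.BilinForm ℝ (V ⊗[ℝ] V)}
    (h : ∀ x y z w : V, S (x ⊗ₜ y) (z ⊗ₜ w) = S (z ⊗ₜ w) (x ⊗ₜ y)) (s t : V ⊗[ℝ] V) :
    S s t = S t s := by
  have : S = LinearMap.BilinForm.flip S := form_ext fun x y z w => h x y z w
  exact LinearMap.congr_fun (LinearMap.congr_fun this s) t

lemma altForm_add (H K : LinearMap.BilinForm ℝ (V ⊗[ℝ] V)) :
    altForm (H + K) = altForm H + altForm K := by
  refine form_ext fun x y z w => ?_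
  simp only [altForm_tmul, LinearMap.add_apply]
  ring

lemma altForm_smul (c : ℝ) (H : LinearMap.BilinForm ℝ (V ⊗[ℝ] V)) :
    altForm (c • H) = c • altForm H := by
  refine form_ext fun x y z w => ?_
  simp only [altForm_tmul, LinearMap.smul_apply, smul_eq_mul]
  ring

namespace IsSymForm

variable {H : LinearMap.BilinForm ℝ (V ⊗[ℝ] V)} (hH : IsSymForm H)
include hH

lemma swap_right (t : V ⊗[ℝ] V) (x y : V) : H t (x ⊗ₜ y) = H t (y ⊗ₜ x) := by
  rw [hH.1, hH.2, hH.1]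

lemma comm_left (s : V ⊗[ℝ] V) : H (TensorProduct.comm ℝ V V s) = H s := by
  have : H ∘ₗ (TensorProduct.comm ℝ V V).toLinearMap = H :=
    TensorProduct.ext' fun x y => by simp [hH.2 y x]
  exact LinearMap.congr_fun this s

lemma altForm_symm (s t : V ⊗[ℝ] V) : altForm H s t = altForm H t s := by
  refine form_symm (fun x y z w => ?_) s t
  rw [altForm_tmul, altForm_tmul, hH.1 (x ⊗ₜ w), hH.2 z y, hH.swap_right _ x w, hH.2 x z,
    hH.swap_right _ y w]

lemma altForm_comm (s : V ⊗[ℝ] V) :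
    altForm H (TensorProduct.comm ℝ V V s) = - altForm H s := by
  have : altForm H ∘ₗ (TensorProduct.comm ℝ V V).toLinearMap = - altForm H :=
    form_ext fun x y z w => by
      simp only [LinearMap.comp_apply, LinearEquiv.coe_coe, TensorProduct.comm_tmul,
        LinearMap.neg_apply, altForm_tmul, hH.1 (y ⊗ₜ w), hH.1 (x ⊗ₜ w)]
      ring
  exact LinearMap.congr_fun this s

lemma altForm_swap (x y : V) : altForm H (x ⊗ₜ y) = - altForm H (y ⊗ₜ x) := by
  rw [← hH.altForm_comm, TensorProduct.comm_tmul]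

lemma altForm_swap_right (s : V ⊗[ℝ] V) (x y : V) :
    altForm H s (x ⊗ₜ y) = - altForm H s (y ⊗ₜ x) := by
  rw [hH.altForm_symm, hH.altForm_swap, LinearMap.neg_apply, hH.altForm_symm]

lemma altForm_self (x : V) : altForm H (x ⊗ₜ x) = 0 := by
  refine LinearMap.ext fun t => ?_
  have := LinearMap.congr_fun (hH.altForm_swap x x) t
  exact self_eq_neg.1 this

lemma liftForm_mem_W : liftForm H ∈ W V := by
  refine ⟨fun s t => ?_, fun s hs t ht => ?_, fun x y z w => ?_⟩
  · simp only [liftForm, LinearMap.add_apply, hH.1 s t, hH.altForm_symm s t]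
  · have hs' : TensorProduct.comm ℝ V V s = s := sub_eq_zero.1 hs
    have ht' : TensorProduct.comm ℝ V V t = -t := eq_neg_of_add_eq_zero_left ht
    have h1 : H s t = 0 := by
      have := LinearMap.congr_fun (hH.comm_left t) s
      rw [ht', map_neg, LinearMap.neg_apply, hH.1 t s] at this
      linarith
    have h2 : altForm H s t = 0 := by
      have := LinearMap.congr_fun (hH.altForm_comm s) t
      rw [hs', LinearMap.neg_apply] at this
      linarith
    rw [liftForm, LinearMap.add_apply, LinearMap.add_apply, h1, h2, add_zero]
  · rw [liftForm_tmul, liftForm_tmul, hH.swap_right (x ⊗ₜ w) y z, hH.swap_right (x ⊗ₜ z) y w,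
      hH.swap_right (x ⊗ₜ y) w z]
    ring

lemma symPart_liftForm : symPart (liftForm H) = H := by
  refine form_ext fun x y z w => ?_
  rw [symPart_tmul, liftForm, LinearMap.add_apply, LinearMap.add_apply, LinearMap.add_apply,
    LinearMap.add_apply, hH.altForm_swap x y, hH.2 x y, LinearMap.neg_apply]
  ring

lemma apply_eq_liftForm (s t : V ⊗[ℝ] V) :
    H s t = (1 / 4) * liftForm H (s + TensorProduct.comm ℝ V V s)
      (t + TensorProduct.comm ℝ V V t) := by
  simp only [liftForm, map_add, LinearMap.add_apply, hH.comm_left, hH.altForm_comm, hH.1 _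
    (TensorProduct.comm ℝ V V t), hH.altForm_symm _ (TensorProduct.comm ℝ V V t),
    LinearMap.neg_apply, hH.1 t, hH.altForm_symm t]
  ring

lemma altForm_apply_eq_liftForm (s t : V ⊗[ℝ] V) :
    altForm H s t = (1 / 4) * liftForm H (s - TensorProduct.comm ℝ V V s)
      (t - TensorProduct.comm ℝ V V t) := by
  simp only [liftForm, map_sub, LinearMap.add_apply, LinearMap.sub_apply, hH.comm_left,
    hH.altForm_comm, hH.1 _ (TensorProduct.comm ℝ V V t),
    hH.altForm_symm _ (TensorProduct.comm ℝ V V t),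
    LinearMap.neg_apply, hH.1 t, hH.altForm_symm t]
  ring

/-- `liftForm H` is positive semi-definite if and only if its two blocks are. -/
lemma liftForm_mem_CW_iff :
    liftForm H ∈ CW V ↔ (∀ t, 0 ≤ H t t) ∧ ∀ t, 0 ≤ altForm H t t := by
  refine ⟨fun h => ⟨fun t => ?_, fun t => ?_⟩, fun h => ⟨hH.liftForm_mem_W, fun t => ?_⟩⟩
  · rw [hH.apply_eq_liftForm]
    exact mul_nonneg (by norm_num) (h.2 _)
  · rw [hH.altForm_apply_eq_liftForm]
    exact mul_nonneg (by norm_num) (h.2 _)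
  · exact add_nonneg (h.1 t) (h.2 t)

lemma spanForm {n : ℕ} (v : Fin n → V ⊗[ℝ] V) {a : Fin n → Fin n → ℝ}
    (ha : ∀ i j, a i j = a j i) : IsSymForm (spanForm H v a) := by
  refine ⟨fun s t => ?_, fun x y => ?_⟩
  · rw [spanForm_apply, spanForm_apply, Finset.sum_comm]
    refine Finset.sum_congr rfl fun i _ => Finset.sum_congr rfl fun j _ => ?_
    rw [ha]; ring
  · ext z w
    simp only [TensorProduct.AlgebraTensorModule.curry_apply, LinearMap.restrictScalars_self,
      TensorProduct.curry_apply, spanForm_apply, hH.swap_right _ x y]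

end IsSymForm

lemma spanForm_eq_zero_of_apply_eq_zero {H : LinearMap.BilinForm ℝ (V ⊗[ℝ] V)}
    (hH : IsSymForm H) {n : ℕ} (v : Fin n → V ⊗[ℝ] V) (a : Fin n → Fin n → ℝ) {t : V ⊗[ℝ] V}
    (ht : H t = 0) : spanForm H v a t = 0 := by
  refine LinearMap.ext fun s => ?_
  rw [spanForm_apply]
  simp [hH.1 _ t, ht]

section OfW

variable {S : LinearMap.BilinForm ℝ (V ⊗[ℝ] V)} (hS : S ∈ W V)
include hS

/-- Orthogonality of `Sym² V` and `Λ² V` means invariance under the simultaneous exchange of the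
arguments in both factors. -/
lemma W.comm_comm (s t : V ⊗[ℝ] V) :
    S (TensorProduct.comm ℝ V V s) (TensorProduct.comm ℝ V V t) = S s t := by
  obtain ⟨h1, h2, -⟩ := hS
  have key : ∀ s t : V ⊗[ℝ] V, S (s + TensorProduct.comm ℝ V V s)
      (t - TensorProduct.comm ℝ V V t) = 0 := fun s t =>
    h2 _ (by simp [SymSq, add_comm]) _ (by simp [AltSq])
  have e1 := key s t
  have e2 := key t s
  simp only [map_add, map_sub, LinearMap.add_apply] at e1 e2
  rw [h1 t s, h1 t, h1 _ s, h1 (TensorProduct.comm ℝ V V t)] at e2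
  linarith

lemma isSymForm_symPart : IsSymForm (symPart S) := by
  refine ⟨fun s t => ?_, fun x y => ?_⟩
  · refine form_symm (fun x y z w => ?_) s t
    have := W.comm_comm hS (y ⊗ₜ x) (z ⊗ₜ w)
    simp only [TensorProduct.comm_tmul] at this
    rw [symPart_tmul, symPart_tmul, hS.1 (z ⊗ₜ w), hS.1 (w ⊗ₜ z), ← this]
  · refine LinearMap.ext fun t => ?_
    rw [symPart_tmul, symPart_tmul, add_comm]

lemma liftForm_symPart : liftForm (symPart S) = S := by
  have h3 := hS.2.2
  have hc : ∀ x y z w : V, S (x ⊗ₜ y) (z ⊗ₜ w) = S (y ⊗ₜ x) (w ⊗ₜ z) := fun x y z w => by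
    simpa using W.comm_comm hS (y ⊗ₜ x) (w ⊗ₜ z)
  refine form_ext fun x y z w => ?_
  rw [liftForm_tmul, symPart_tmul, symPart_tmul, symPart_tmul, h3 x w y z, hc w x y z,
    h3 x w z y, hc y x z w, h3 x y w z, hc x z w y]
  ring

end OfW

end SymmetricPart

/-! ### Bases of a three-dimensional space -/

section Bases

variable {V : Type*} [AddCommGroup V] [Module ℝ V]

lemma exists_basis_of_pair (hV : Module.finrank ℝ V = 3) {x y : V}
    (h : LinearIndependent ℝ ![x, y]) :
    ∃ b : Module.Basis (Fin 3) ℝ V, b 0 = x ∧ b 1 = y := by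
  have : FiniteDimensional ℝ V := Module.finite_of_finrank_pos (by omega)
  obtain ⟨w, hw⟩ : ∃ w, w ∉ Submodule.span ℝ (Set.range ![x, y]) := by
    by_contra! hcon
    have h1 := finrank_range_le_card (R := ℝ) ![x, y]
    rw [Set.finrank, Submodule.eq_top_iff'.2 hcon, finrank_top, hV] at h1
    simp at h1
  have h2 := h.finSnoc hw
  refine ⟨basisOfLinearIndependentOfCardEqFinrank h2 (by simp [hV]), ?_, ?_⟩
  · rw [coe_basisOfLinearIndependentOfCardEqFinrank]; rfl
  · rw [coe_basisOfLinearIndependentOfCardEqFinrank]; rfl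

lemma exists_basis_of_pair' (hV : Module.finrank ℝ V = 3) {x y : V}
    (h : LinearIndependent ℝ ![x, y]) :
    ∃ b : Module.Basis (Fin 3) ℝ V, b 1 = x ∧ b 2 = y := by
  obtain ⟨b, hx, hy⟩ := exists_basis_of_pair hV h
  refine ⟨b.reindex (finRotate 3), ?_, ?_⟩
  · rw [Module.Basis.reindex_apply, ← hx]; congr 1
  · rw [Module.Basis.reindex_apply, ← hy]; congr 1

lemma exists_basis_of_ne_zero (hV : Module.finrank ℝ V = 3) {z : V} (hz : z ≠ 0) :
    ∃ b : Module.Basis (Fin 3) ℝ V, b 0 = z := by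
  have : FiniteDimensional ℝ V := Module.finite_of_finrank_pos (by omega)
  obtain ⟨y, hy⟩ : ∃ y, y ∉ Submodule.span ℝ {z} := by
    by_contra! hcon
    have h1 := finrank_span_singleton (K := ℝ) hz
    rw [Submodule.eq_top_iff'.2 hcon, finrank_top, hV] at h1
    omega
  have h : LinearIndependent ℝ ![z, y] := by
    rw [LinearIndependent.pair_iff' hz]
    intro a ha
    exact hy (ha ▸ Submodule.smul_mem _ _ (Submodule.mem_span_singleton_self z))
  obtain ⟨b, hb, -⟩ := exists_basis_of_pair hV h
  exact ⟨b, hb⟩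

lemma basis_pair (b : Module.Basis (Fin 3) ℝ V) {i j : Fin 3} (hij : i ≠ j) :
    LinearIndependent ℝ ![b i, b j] := by
  have : ![b i, b j] = b ∘ ![i, j] := by
    ext k; fin_cases k <;> rfl
  rw [this]
  refine b.linearIndependent.comp _ ?_
  intro k l h
  fin_cases k <;> fin_cases l <;> simp_all

end Bases

/-! ### Alternating forms in dimension three -/

section Alternating

variable {V : Type*} [AddCommGroup V] [Module ℝ V]
variable {H : LinearMap.BilinForm ℝ (V ⊗[ℝ] V)}

lemma apply_swap_of_altForm_eq_zero {x y : V} (h : altForm H (x ⊗ₜ y) = 0) (z w : V) :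
    H (x ⊗ₜ w) (y ⊗ₜ z) = H (x ⊗ₜ z) (y ⊗ₜ w) := by
  have := LinearMap.congr_fun h (z ⊗ₜ w)
  rw [altForm_tmul, LinearMap.zero_apply] at this
  linarith

lemma IsSymForm.altForm_eq_zero_of_dependent (hH : IsSymForm H) {x y : V}
    (h : ¬ LinearIndependent ℝ ![x, y]) : altForm H (x ⊗ₜ y) = 0 := by
  by_cases hx : x = 0
  · simp [hx]
  · rw [LinearIndependent.pair_iff' hx] at h
    push Not at h
    obtain ⟨a, rfl⟩ := h
    rw [TensorProduct.tmul_smul, map_smul, hH.altForm_self, smul_zero]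

lemma exists_sub_comm_eq (b : Module.Basis (Fin 3) ℝ V) (t : V ⊗[ℝ] V) :
    ∃ p q r : ℝ, t - TensorProduct.comm ℝ V V t = p • (b 0 ⊗ₜ b 1 - b 1 ⊗ₜ b 0) +
      q • (b 0 ⊗ₜ b 2 - b 2 ⊗ₜ b 0) + r • (b 1 ⊗ₜ b 2 - b 2 ⊗ₜ b 1) := by
  let c := (b.tensorProduct b).repr t
  refine ⟨c (0, 1) - c (1, 0), c (0, 2) - c (2, 0), c (1, 2) - c (2, 1), ?_⟩
  conv_lhs => rw [← (b.tensorProduct b).sum_repr t]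
  simp only [Fintype.sum_prod_type, Fin.sum_univ_three, map_add, map_smul,
    Module.Basis.tensorProduct_apply, TensorProduct.comm_tmul]
  module

/-- The coordinates of the antisymmetric part of a tensor, as seen by alternating forms. -/
lemma exists_altForm_eq (b : Module.Basis (Fin 3) ℝ V) (t : V ⊗[ℝ] V) :
    ∃ p q r : ℝ, ∀ K : LinearMap.BilinForm ℝ (V ⊗[ℝ] V), IsSymForm K →
      altForm K t = p • altForm K (b 0 ⊗ₜ b 1) + q • altForm K (b 0 ⊗ₜ b 2) +
        r • altForm K (b 1 ⊗ₜ b 2) := by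
  obtain ⟨p, q, r, h⟩ := exists_sub_comm_eq b t
  refine ⟨p, q, r, fun K hK => LinearMap.ext fun s => ?_⟩
  have h1 := LinearMap.congr_fun (congrArg (altForm K) h) s
  simp only [map_sub, map_add, map_smul, hK.altForm_comm, hK.altForm_swap (b 1) (b 0),
    hK.altForm_swap (b 2) (b 0), hK.altForm_swap (b 2) (b 1), LinearMap.sub_apply,
    LinearMap.add_apply, LinearMap.smul_apply, LinearMap.neg_apply, smul_eq_mul] at h1 ⊢
  linarith

/-- In dimension three every element of `Λ² V` is decomposable. -/
lemma exists_altForm_eq_tmul (b : Module.Basis (Fin 3) ℝ V) (t : V ⊗[ℝ] V) :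
    ∃ x y : V, ∀ K : LinearMap.BilinForm ℝ (V ⊗[ℝ] V), IsSymForm K →
      altForm K t = altForm K (x ⊗ₜ y) := by
  obtain ⟨p, q, r, h⟩ := exists_altForm_eq b t
  by_cases hp : p = 0
  · refine ⟨q • b 0 + r • b 1, b 2, fun K hK => ?_⟩
    rw [h K hK, hp]
    simp only [TensorProduct.add_tmul, ← TensorProduct.smul_tmul', map_add, map_smul]
    module
  · refine ⟨b 0 - (r / p) • b 2, p • b 1 + q • b 2, fun K hK => ?_⟩
    rw [h K hK]
    simp only [TensorProduct.sub_tmul, TensorProduct.tmul_add, ← TensorProduct.smul_tmul',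
      TensorProduct.tmul_smul, map_add, map_smul, map_sub, hK.altForm_self,
      hK.altForm_swap (b 2) (b 1)]
    refine LinearMap.ext fun s => ?_
    simp only [LinearMap.add_apply, LinearMap.sub_apply, LinearMap.smul_apply, smul_eq_mul,
      LinearMap.neg_apply, LinearMap.zero_apply]
    field_simp
    ring

lemma IsSymForm.altForm_apply_eq_zero (hH : IsSymForm H) (b : Module.Basis (Fin 3) ℝ V)
    {s : V ⊗[ℝ] V} (h01 : altForm H s (b 0 ⊗ₜ b 1) = 0) (h02 : altForm H s (b 0 ⊗ₜ b 2) = 0)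
    (h12 : altForm H s (b 1 ⊗ₜ b 2) = 0) : altForm H s = 0 := by
  refine LinearMap.ext fun t => ?_
  obtain ⟨p, q, r, h⟩ := exists_altForm_eq b t
  rw [hH.altForm_symm, h H hH]
  simp [hH.altForm_symm _ s, h01, h02, h12]

end Alternating

/-! ### Kernel conditions and dimension counts -/

section Perturbation

variable {V : Type*} [AddCommGroup V] [Module ℝ V] [FiniteDimensional ℝ V]
variable {H : LinearMap.BilinForm ℝ (V ⊗[ℝ] V)}

/-- If `liftForm H` is extremal, then the multiples of `H` are the only symmetric forms that
satisfy the kernel conditions of both blocks. -/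
lemma IsSymForm.exists_smul_eq (hH : IsSymForm H) (hext : IsExtremal (CW V) (liftForm H))
    {K : LinearMap.BilinForm ℝ (V ⊗[ℝ] V)} (hK : IsSymForm K) (h1 : ∀ t, H t = 0 → K t = 0)
    (h2 : ∀ t, altForm H t = 0 → altForm K t = 0) : ∃ c : ℝ, K = c • H := by
  obtain ⟨hp, ha⟩ := hH.liftForm_mem_CW_iff.1 hext.1
  obtain ⟨c, hc⟩ := hext.exists_smul_eq (M := W V) (fun T => Iff.rfl) (fun T hT => hT.1)
    hK.liftForm_mem_W (fun t ht => by
      have h3 : H t t + altForm H t t = 0 := LinearMap.congr_fun ht t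
      have h4 := hp t
      have h5 := ha t
      rw [liftForm, LinearMap.add_apply, h1 t (apply_eq_zero_of_self hH.1 hp (by linarith)),
        h2 t (apply_eq_zero_of_self hH.altForm_symm ha (by linarith)), add_zero])
  refine ⟨c, ?_⟩
  rw [← hK.symPart_liftForm, hc]
  conv_rhs => rw [← hH.symPart_liftForm]
  refine form_ext fun x y z w => ?_
  simp only [symPart_tmul, LinearMap.smul_apply, smul_eq_mul]
  ring

/-- Extremality fails as soon as the kernel conditions on the alternating block amount to few
linear equations, compared with the number of orthonormal vectors for `H`. -/
lemma IsSymForm.false_of_conditions (hH : IsSymForm H)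
    (hext : IsExtremal (CW V) (liftForm H)) {n : ℕ} {v : Fin n → V ⊗[ℝ] V}
    (hv : ∀ i j, H (v i) (v j) = if i = j then 1 else 0) (k : ℕ) (hk : k ≤ n) {m : ℕ}
    (p : Fin m → (V ⊗[ℝ] V) × (V ⊗[ℝ] V)) (hm : m + 1 < k * (k + 1) / 2)
    (hcond : ∀ K : LinearMap.BilinForm ℝ (V ⊗[ℝ] V), IsSymForm K → (∀ t, H t = 0 → K t = 0) →
      (∀ i, altForm K (p i).1 (p i).2 = 0) → ∀ t, altForm H t = 0 → altForm K t = 0) :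
    False := by
  obtain ⟨a, ha, hL, hne⟩ := exists_spanForm (H := H) (n := k)
    (v := fun i => v (Fin.castLE hk i))
    (fun i j => by simp [hv, Fin.ext_iff])
    (L := fun K i => altForm K (p i).1 (p i).2)
    ⟨fun K K' => by ext i; simp [altForm_add], fun c K => by ext i; simp [altForm_smul]⟩ hm
  have h1 := fun t (ht : H t = 0) =>
    spanForm_eq_zero_of_apply_eq_zero hH (fun i => v (Fin.castLE hk i)) a ht
  obtain ⟨c, hc⟩ := hH.exists_smul_eq hext (hH.spanForm _ ha) h1
    (hcond _ (hH.spanForm _ ha) h1 (congr_fun hL))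
  exact hne c hc

variable (hH : IsSymForm H) (hext : IsExtremal (CW V) (liftForm H))
  {n : ℕ} {v : Fin n → V ⊗[ℝ] V} (hv : ∀ i j, H (v i) (v j) = if i = j then 1 else 0)
include hH hext hv

lemma IsSymForm.rank_le_three (b : Module.Basis (Fin 3) ℝ V) : n ≤ 3 := by
  by_contra! hn
  refine hH.false_of_conditions hext hv 4 hn
    ![(b 0 ⊗ₜ b 1, b 0 ⊗ₜ b 1), (b 0 ⊗ₜ b 1, b 0 ⊗ₜ b 2), (b 0 ⊗ₜ b 1, b 1 ⊗ₜ b 2),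
      (b 0 ⊗ₜ b 2, b 0 ⊗ₜ b 2), (b 0 ⊗ₜ b 2, b 1 ⊗ₜ b 2), (b 1 ⊗ₜ b 2, b 1 ⊗ₜ b 2)]
    (by norm_num) fun K hK _ hp t _ => ?_
  have h1 := hp 0
  have h2 := hp 1
  have h3 := hp 2
  have h4 := hp 3
  have h5 := hp 4
  have h6 := hp 5
  simp only [Fin.isValue, Matrix.cons_val] at h1 h2 h3 h4 h5 h6
  have e1 := hK.altForm_apply_eq_zero b h1 h2 h3
  have e2 := hK.altForm_apply_eq_zero b (by rw [hK.altForm_symm, h2]) h4 h5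
  have e3 := hK.altForm_apply_eq_zero b (by rw [hK.altForm_symm, h3])
    (by rw [hK.altForm_symm, h5]) h6
  obtain ⟨p, q, r, h⟩ := exists_altForm_eq b t
  rw [h K hK, e1, e2, e3]
  simp

/-- The alternating block has a kernel when `H` is not of rank one. -/
lemma IsSymForm.exists_altForm_eq_zero (b : Module.Basis (Fin 3) ℝ V) (hn : 2 ≤ n) :
    ∃ x y : V, LinearIndependent ℝ ![x, y] ∧ altForm H (x ⊗ₜ y) = 0 := by
  by_contra! hx
  refine hH.false_of_conditions hext hv 2 hn (m := 0) Fin.elim0 (by norm_num)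
    fun K hK _ _ t ht => ?_
  obtain ⟨x, y, h⟩ := exists_altForm_eq_tmul b t
  rw [h K hK]
  refine hK.altForm_eq_zero_of_dependent fun hli => hx x y hli ?_
  rw [← h H hH, ht]

/-- When `H` is not of rank one, no nonzero vector lies in the radical of all the quadratic forms in
the image of `H`. Otherwise these would be binary forms, and only one condition would be left. -/
lemma IsSymForm.eq_zero_of_forall_tmul (hV : Module.finrank ℝ V = 3) (hn : 2 ≤ n) {y : V}
    (hy : ∀ x, H (y ⊗ₜ x) = 0) : y = 0 := by
  by_contra hy0
  obtain ⟨b, rfl⟩ := exists_basis_of_ne_zero hV hy0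
  refine hH.false_of_conditions hext hv 2 hn (m := 1) ![(b 1 ⊗ₜ b 2, b 1 ⊗ₜ b 2)] (by norm_num)
    fun K hK hker hp t _ => ?_
  have h0 : ∀ x, altForm K (b 0 ⊗ₜ x) = 0 := fun x => form_ext_left fun z w => by
    rw [altForm_tmul, hker _ (hy _), hker _ (hy _)]
    simp
  have h1 := hp 0
  simp only [Fin.isValue, Matrix.cons_val] at h1
  have e3 := hK.altForm_apply_eq_zero b (s := b 1 ⊗ₜ b 2) (by rw [hK.altForm_symm, h0]; rfl)
    (by rw [hK.altForm_symm, h0]; rfl) h1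
  obtain ⟨p, q, r, h⟩ := exists_altForm_eq b t
  rw [h K hK, h0, h0, e3]
  simp

end Perturbation

/-! ### The rank of the alternating block is at most one -/

section AlternatingRankTwo

variable {V : Type*} [AddCommGroup V] [Module ℝ V]
variable {H : LinearMap.BilinForm ℝ (V ⊗[ℝ] V)}

/-- If the kernel of the alternating block is the line of `b₁ ∧ b₂`, then only `b₁ ∧ b₂` has to be
tested in order to know that an alternating form vanishes on this kernel. -/
lemma IsSymForm.altForm_ker_of_line (hH : IsSymForm H)
    (hz : ∀ z, (∀ x, altForm H (z ⊗ₜ x) = 0) → z = 0) (b : Module.Basis (Fin 3) ℝ V)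
    (hb : altForm H (b 1 ⊗ₜ b 2) = 0) {K : LinearMap.BilinForm ℝ (V ⊗[ℝ] V)} (hK : IsSymForm K)
    (hKb : altForm K (b 1 ⊗ₜ b 2) = 0) (t : V ⊗[ℝ] V) (ht : altForm H t = 0) :
    altForm K t = 0 := by
  obtain ⟨p, q, r, h⟩ := exists_altForm_eq b t
  have h1 : altForm H (b 0 ⊗ₜ (p • b 1 + q • b 2)) = 0 := by
    have := h H hH
    rw [ht, hb, smul_zero, add_zero] at this
    rw [TensorProduct.tmul_add, TensorProduct.tmul_smul, TensorProduct.tmul_smul, map_add,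
      map_smul, map_smul, ← this]
  have h2 : p • b 1 + q • b 2 = 0 := by
    refine hz _ fun x => ?_
    rw [← b.sum_repr x]
    have h3 : altForm H ((p • b 1 + q • b 2) ⊗ₜ b 0) = 0 := by
      rw [hH.altForm_swap, h1, neg_zero]
    have h4 : altForm H ((p • b 1 + q • b 2) ⊗ₜ b 1) = 0 := by
      simp only [TensorProduct.add_tmul, ← TensorProduct.smul_tmul', map_add, map_smul,
        hH.altForm_self, hH.altForm_swap (b 2) (b 1), hb]
      simp
    have h5 : altForm H ((p • b 1 + q • b 2) ⊗ₜ b 2) = 0 := by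
      simp only [TensorProduct.add_tmul, ← TensorProduct.smul_tmul', map_add, map_smul,
        hH.altForm_self, hb]
      simp
    simp only [Fin.sum_univ_three, TensorProduct.tmul_add, TensorProduct.tmul_smul, map_add,
      map_smul, h3, h4, h5]
    simp
  obtain ⟨hp, hq⟩ := LinearIndependent.pair_iff.1 (basis_pair b (i := 1) (j := 2) (by decide))
    p q h2
  rw [h K hK, hp, hq, hKb]
  simp

/-- On a plane spanned by `x` and `y` with `x ∧ y` in the kernel of the alternating block, `H` is a
Hankel form. If it is degenerate there, its kernel contains `x' ∨ y'` for a basis `x'`, `y'` of the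
plane. -/
lemma IsSymForm.exists_pair_apply_eq_zero (hH : IsSymForm H) (hp : ∀ t, 0 ≤ H t t) {x y : V}
    (hxy : LinearIndependent ℝ ![x, y]) (h0 : altForm H (x ⊗ₜ y) = 0) {c : Fin 3 → ℝ}
    (hc0 : c ≠ 0)
    (hc : H (c 0 • (x ⊗ₜ[ℝ] x) + c 1 • (x ⊗ₜ[ℝ] y) + c 2 • (y ⊗ₜ[ℝ] y)) = 0) :
    ∃ x' y' : V, LinearIndependent ℝ ![x', y'] ∧ altForm H (x' ⊗ₜ y') = 0 ∧
      H (x' ⊗ₜ y') = 0 := by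
  have hdet : ∀ a₁ a₂ a₃ a₄ : ℝ, a₁ * a₄ - a₂ * a₃ ≠ 0 →
      LinearIndependent ℝ ![a₁ • x + a₂ • y, a₃ • x + a₄ • y] ∧
        altForm H ((a₁ • x + a₂ • y) ⊗ₜ (a₃ • x + a₄ • y)) = 0 := by
    intro a₁ a₂ a₃ a₄ h
    constructor
    · rw [LinearIndependent.pair_iff] at hxy ⊢
      intro s t hst
      obtain ⟨h1, h2⟩ := hxy (s * a₁ + t * a₃) (s * a₂ + t * a₄) (by rw [← hst]; module)
      constructor
      · have : s * (a₁ * a₄ - a₂ * a₃) = 0 := by linear_combination a₄ * h1 - a₃ * h2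
        exact (mul_eq_zero.1 this).resolve_right h
      · have : t * (a₁ * a₄ - a₂ * a₃) = 0 := by linear_combination a₁ * h2 - a₂ * h1
        exact (mul_eq_zero.1 this).resolve_right h
    · simp only [TensorProduct.add_tmul, TensorProduct.tmul_add, ← TensorProduct.smul_tmul',
        TensorProduct.tmul_smul, map_add, map_smul, hH.altForm_self, hH.altForm_swap y x, h0]
      simp
  -- the case of a square in the kernel, or of a definite element
  have hsq : ∀ x y : V, LinearIndependent ℝ ![x, y] → altForm H (x ⊗ₜ y) = 0 → ∀ s : ℝ, s ≤ 0 →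
      H (x ⊗ₜ x) = s • H (y ⊗ₜ y) → ∃ x' y' : V, LinearIndependent ℝ ![x', y'] ∧
        altForm H (x' ⊗ₜ y') = 0 ∧ H (x' ⊗ₜ y') = 0 := by
    intro x y hxy h0 s hs hsx
    refine ⟨x, y, hxy, h0, apply_eq_zero_of_self hH.1 hp (le_antisymm ?_ (hp _))⟩
    rw [hH.swap_right, apply_swap_of_altForm_eq_zero h0, hsx]
    exact mul_nonpos_of_nonpos_of_nonneg hs (hp _)
  by_cases hc2 : c 0 = 0
  · by_cases hc1 : c 1 = 0
    · have hc3 : c 2 ≠ 0 := fun h => hc0 (by ext i; fin_cases i <;> simp_all)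
      have hyy : H (y ⊗ₜ y) = 0 := by simpa [hc2, hc1, hc3] using hc
      refine hsq y x ?_ (by rw [hH.altForm_swap, h0, neg_zero]) 0 le_rfl (by simp [hyy])
      rw [LinearIndependent.pair_symm_iff]; exact hxy
    · obtain ⟨h1, h2⟩ := hdet 0 1 (c 1) (c 2) (by simpa using hc1)
      refine ⟨_, _, h1, h2, ?_⟩
      rw [← hc, hc2]
      simp only [TensorProduct.add_tmul, TensorProduct.tmul_add, ← TensorProduct.smul_tmul',
        TensorProduct.tmul_smul, map_add, map_smul, hH.2 y x]
      module
  · obtain ⟨h1, h2⟩ := hdet 1 (c 1 / (2 * c 0)) 0 1 (by simp)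
    set s : ℝ := (c 1 / (2 * c 0)) ^ 2 - c 2 / c 0 with hs
    have hx : H ((x + (c 1 / (2 * c 0)) • y) ⊗ₜ (x + (c 1 / (2 * c 0)) • y)) =
        s • H (y ⊗ₜ y) := by
      have h3 : (1 / c 0) •
          H (c 0 • (x ⊗ₜ[ℝ] x) + c 1 • (x ⊗ₜ[ℝ] y) + c 2 • (y ⊗ₜ[ℝ] y)) = 0 := by
        rw [hc, smul_zero]
      rw [← sub_eq_zero, ← h3]
      simp only [TensorProduct.add_tmul, TensorProduct.tmul_add, ← TensorProduct.smul_tmul',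
        TensorProduct.tmul_smul, map_add, map_smul, hH.2 y x]
      refine LinearMap.ext fun t => ?_
      simp only [LinearMap.add_apply, LinearMap.sub_apply, LinearMap.smul_apply, smul_eq_mul, hs]
      field_simp
      ring
    simp only [one_smul, zero_smul, zero_add] at h1 h2
    by_cases hs0 : s ≤ 0
    · exact hsq _ _ h1 h2 s hs0 hx
    · push Not at hs0
      have hq : Real.sqrt s ≠ 0 := (Real.sqrt_pos.2 hs0).ne'
      obtain ⟨h3, h4⟩ := hdet 1 (c 1 / (2 * c 0) - Real.sqrt s) 1 (c 1 / (2 * c 0) + Real.sqrt s)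
        (by intro h; apply hq; linarith)
      refine ⟨_, _, h3, h4, ?_⟩
      rw [← sub_eq_zero] at hx
      rw [← hx]
      simp only [TensorProduct.add_tmul, TensorProduct.tmul_add, ← TensorProduct.smul_tmul',
        TensorProduct.tmul_smul, map_add, map_smul, hH.2 y x, one_smul]
      refine LinearMap.ext fun t => ?_
      simp only [LinearMap.add_apply, LinearMap.sub_apply, LinearMap.smul_apply, smul_eq_mul]
      linear_combination (-(H (y ⊗ₜ[ℝ] y) t)) * Real.sq_sqrt hs0.le

variable [FiniteDimensional ℝ V]
variable (hH : IsSymForm H) (hext : IsExtremal (CW V) (liftForm H))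
  {n : ℕ} {v : Fin n → V ⊗[ℝ] V} (hv : ∀ i j, H (v i) (v j) = if i = j then 1 else 0)
  (hz : ∀ z, (∀ x, altForm H (z ⊗ₜ x) = 0) → z = 0)
include hH hext hv hz

/-- If `b₁ ∨ b₁` and `b₁ ∨ b₂` are in the kernel of `H`, the equations for `b₁ ∧ b₂` to stay in the
kernel of the alternating block reduce to a single one. -/
lemma IsSymForm.apply_self_ne_zero (hn : 2 ≤ n) (b : Module.Basis (Fin 3) ℝ V)
    (hb : altForm H (b 1 ⊗ₜ b 2) = 0) (hb' : H (b 1 ⊗ₜ b 2) = 0) : H (b 1 ⊗ₜ b 1) ≠ 0 := by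
  intro h11
  refine hH.false_of_conditions hext hv 2 hn (m := 1) ![(b 1 ⊗ₜ b 2, b 0 ⊗ₜ b 2)] (by norm_num)
    fun K hK hker hp => hH.altForm_ker_of_line hz b hb hK ?_
  have h1 := hp 0
  simp only [Fin.isValue, Matrix.cons_val] at h1
  have h12 : K (b 2 ⊗ₜ b 1) = 0 := by rw [hK.2]; exact hker _ hb'
  have h12' := hker _ hb'
  have h11' := hker _ h11
  refine hK.altForm_apply_eq_zero b ?_ h1 ?_
  · rw [altForm_tmul, h11', hK.1, h12]; simp
  · rw [altForm_tmul, h12', h11']; simp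

/-- If `b₁ ∨ b₂` is in the kernel of `H`, then `H` is the sum of a part that comes from `b₁ ∨ b₁` and
a part orthogonal to it, and this contradicts extremality. -/
lemma IsSymForm.not_two_le_of_apply_eq_zero (b : Module.Basis (Fin 3) ℝ V)
    (hb : altForm H (b 1 ⊗ₜ b 2) = 0) (hb' : H (b 1 ⊗ₜ b 2) = 0) : ¬ 2 ≤ n := by
  intro hn
  have h1 := hH.apply_self_ne_zero hext hv hz hn b hb hb'
  have h2 := hH.apply_self_ne_zero hext hv hz hn (b.reindex (Equiv.swap 1 2))
    (by
      simp only [Module.Basis.reindex_apply, Equiv.symm_swap, Equiv.swap_apply_left,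
        Equiv.swap_apply_right]
      rw [hH.altForm_swap, hb, neg_zero])
    (by
      simp only [Module.Basis.reindex_apply, Equiv.symm_swap, Equiv.swap_apply_left,
        Equiv.swap_apply_right]
      rw [hH.2, hb'])
  simp only [Module.Basis.reindex_apply, Equiv.symm_swap, Equiv.swap_apply_left] at h2
  have hp := (hH.liftForm_mem_CW_iff.1 hext.1).1
  have h21 : H (b 2 ⊗ₜ b 1) = 0 := by rw [hH.2, hb']
  have e1 : H (b 1 ⊗ₜ b 1) (b 2 ⊗ₜ b 2) = 0 := by
    rw [apply_swap_of_altForm_eq_zero hb, hb', LinearMap.zero_apply]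
  have e2 : H (b 1 ⊗ₜ b 1) (b 0 ⊗ₜ b 2) = 0 := by
    rw [hH.swap_right, apply_swap_of_altForm_eq_zero hb, hH.1, h21, LinearMap.zero_apply]
  -- the square of `H (b₁ ⊗ b₁)` satisfies the same kernel conditions as `H`
  have hK := hH.spanForm (fun _ : Fin 1 => b 1 ⊗ₜ[ℝ] b 1) (a := fun _ _ => 1) fun _ _ => rfl
  obtain ⟨c, hc⟩ := hH.exists_smul_eq hext hK
    (fun t => spanForm_eq_zero_of_apply_eq_zero hH _ _)
    (hH.altForm_ker_of_line hz b hb hK (by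
      refine hK.altForm_apply_eq_zero b ?_ ?_ ?_ <;>
      simp [altForm_tmul, spanForm_apply, e1, e2, hH.1 _ (b 1 ⊗ₜ[ℝ] b 2),
        hH.1 _ (b 2 ⊗ₜ[ℝ] b 1), hb', h21, hH.swap_right _ (b 2) (b 0)]))
  have h3 : H (b 1 ⊗ₜ b 1) (b 1 ⊗ₜ b 1) ≠ 0 := fun h => h1 (apply_eq_zero_of_self hH.1 hp h)
  have h4 : H (b 2 ⊗ₜ b 2) (b 2 ⊗ₜ b 2) ≠ 0 := fun h => h2 (apply_eq_zero_of_self hH.1 hp h)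
  have e3 := LinearMap.congr_fun (LinearMap.congr_fun hc (b 2 ⊗ₜ b 2)) (b 2 ⊗ₜ b 2)
  have e4 := LinearMap.congr_fun (LinearMap.congr_fun hc (b 1 ⊗ₜ b 1)) (b 1 ⊗ₜ b 1)
  simp [spanForm_apply, e1, h4] at e3
  simp [spanForm_apply, e3, h3] at e4

omit hz in
/-- When `H` is not of rank one, the kernel of the alternating block contains `z ∧ V` for some
`z ≠ 0`: the alternating block has rank at most one. -/
lemma IsSymForm.exists_forall_altForm_eq_zero (hV : Module.finrank ℝ V = 3) (hn : 2 ≤ n)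
    (he : ∀ x y, H x y = ∑ i, H x (v i) * H y (v i)) :
    ∃ z : V, z ≠ 0 ∧ ∀ x, altForm H (z ⊗ₜ x) = 0 := by
  by_contra! hz'
  have hz : ∀ z, (∀ x, altForm H (z ⊗ₜ x) = 0) → z = 0 := by
    intro z hz
    by_contra h
    obtain ⟨x, hx⟩ := hz' z h
    exact hx (hz x)
  have hp := (hH.liftForm_mem_CW_iff.1 hext.1).1
  obtain ⟨x, y, hxy, h0⟩ := hH.exists_altForm_eq_zero hext hv
    (Module.finBasisOfFinrankEq ℝ V hV) hn
  -- in rank three, three conditions and the exclusion of `H` do not exhaust six dimensions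
  by_cases hn3 : 3 ≤ n
  · obtain ⟨b, rfl, rfl⟩ := exists_basis_of_pair' hV hxy
    refine hH.false_of_conditions hext hv 3 hn3 (m := 3)
      ![(b 1 ⊗ₜ b 2, b 0 ⊗ₜ b 1), (b 1 ⊗ₜ b 2, b 0 ⊗ₜ b 2), (b 1 ⊗ₜ b 2, b 1 ⊗ₜ b 2)]
      (by norm_num) fun K hK hker hp => hH.altForm_ker_of_line hz b h0 hK
        (hK.altForm_apply_eq_zero b (hp 0) (hp 1) (hp 2))
  · -- three vectors and a form of rank two: some combination lies in the kernel
    let f : (Fin 3 → ℝ) →ₗ[ℝ] (Fin n → ℝ) := LinearMap.pi fun i =>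
      ∑ j : Fin 3, (LinearMap.proj j).smulRight (H (![x ⊗ₜ x, x ⊗ₜ y, y ⊗ₜ y] j) (v i))
    have hf := LinearMap.ker_ne_bot_of_finrank_lt (f := f) (by simp; omega)
    obtain ⟨c, hc, hc0⟩ := (Submodule.ne_bot_iff _).1 hf
    obtain ⟨x', y', hxy', h1, h2⟩ := hH.exists_pair_apply_eq_zero hp hxy h0 hc0 (by
      refine LinearMap.ext fun t => ?_
      rw [he, LinearMap.zero_apply]
      refine Finset.sum_eq_zero fun i _ => ?_
      have := congr_fun (LinearMap.mem_ker.1 hc) i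
      simp only [f, LinearMap.pi_apply, LinearMap.add_apply, Fin.sum_univ_three,
        LinearMap.smulRight_apply, LinearMap.proj_apply, smul_eq_mul, Pi.zero_apply,
        Matrix.cons_val] at this
      simp only [map_add, map_smul, LinearMap.add_apply, LinearMap.smul_apply, smul_eq_mul, this,
        zero_mul])
    obtain ⟨b, rfl, rfl⟩ := exists_basis_of_pair' hV hxy'
    exact hH.not_two_le_of_apply_eq_zero hext hv hz b h1 h2 hn

end AlternatingRankTwo

/-! ### Nondegeneracy on `z ∨ V` -/

section AlternatingRankOne

variable {V : Type*} [AddCommGroup V] [Module ℝ V] [FiniteDimensional ℝ V]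
variable {H : LinearMap.BilinForm ℝ (V ⊗[ℝ] V)}

/-- For an extremal tensor with `H` not of rank one, the kernel of `H` meets `z ∨ V` trivially when
`z ∧ V` is in the kernel of the alternating block. -/
lemma IsSymForm.eq_zero_of_apply_tmul_eq_zero (hV : Module.finrank ℝ V = 3) (hH : IsSymForm H)
    (hext : IsExtremal (CW V) (liftForm H))
    {n : ℕ} {v : Fin n → V ⊗[ℝ] V} (hv : ∀ i j, H (v i) (v j) = if i = j then 1 else 0)
    (hn : 2 ≤ n) {z : V} (hz0 : z ≠ 0) (hz : ∀ x, altForm H (z ⊗ₜ x) = 0) {y : V}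
    (hy : H (z ⊗ₜ y) = 0) : y = 0 := by
  by_contra hy0
  have hp := (hH.liftForm_mem_CW_iff.1 hext.1).1
  have hD := fun {y} => hH.eq_zero_of_forall_tmul hext hv hV hn (y := y)
  by_cases hzy : LinearIndependent ℝ ![z, y]
  · obtain ⟨b, rfl, rfl⟩ := exists_basis_of_pair hV hzy
    have h10 : H (b 1 ⊗ₜ b 0) = 0 := by rw [hH.2, hy]
    -- `⟨b₀ ∨ b₀, b₀ ∨ b₂⟩` and `⟨b₁ ∨ b₁, b₁ ∨ b₂⟩` are orthogonal
    have e1 : H (b 0 ⊗ₜ b 0) (b 1 ⊗ₜ b 1) = 0 := by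
      rw [apply_swap_of_altForm_eq_zero (hz _), hy, LinearMap.zero_apply]
    have e2 : H (b 0 ⊗ₜ b 0) (b 1 ⊗ₜ b 2) = 0 := by
      rw [apply_swap_of_altForm_eq_zero (hz _), hH.1, h10, LinearMap.zero_apply]
    have e3 : H (b 0 ⊗ₜ b 2) (b 1 ⊗ₜ b 1) = 0 := by
      rw [apply_swap_of_altForm_eq_zero (hz _), hy, LinearMap.zero_apply]
    have e4 : H (b 0 ⊗ₜ b 2) (b 1 ⊗ₜ b 2) = 0 := by
      rw [hH.swap_right, apply_swap_of_altForm_eq_zero (hz _), hy, LinearMap.zero_apply]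
    -- the part of `H` carried by the second plane has the same alternating block as `H`
    obtain ⟨m, w, a, ha, hu, hperp⟩ := exists_projection hH.1 hp
      (Submodule.span ℝ {b 1 ⊗ₜ[ℝ] b 1, b 1 ⊗ₜ[ℝ] b 2})
    set K := PositivityCone.spanForm H w a with hKdef
    have hK : IsSymForm K := hH.spanForm w ha
    have hmem : ∀ p, H p (b 1 ⊗ₜ b 1) = 0 → H p (b 1 ⊗ₜ b 2) = 0 → K p = 0 := by
      intro p h1 h2
      refine hperp p fun u hu => ?_
      obtain ⟨c, d, rfl⟩ := Submodule.mem_span_pair.1 hu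
      simp [h1, h2]
    have k00 := hmem _ e1 e2
    have k02 := hmem _ e3 e4
    have k01 := hmem (b 0 ⊗ₜ b 1) (by rw [hy]; rfl) (by rw [hy]; rfl)
    have k11 := hu (b 1 ⊗ₜ b 1) (Submodule.subset_span (by simp))
    have k12 := hu (b 1 ⊗ₜ b 2) (Submodule.subset_span (by simp))
    have k0 : ∀ x, K (b 0 ⊗ₜ x) = 0 := by
      intro x
      rw [← b.sum_repr x]
      simp only [Fin.sum_univ_three, TensorProduct.tmul_add, TensorProduct.tmul_smul, map_add,
        map_smul, k00, k01, k02, smul_zero, add_zero]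
    have a0 : ∀ x, altForm K (b 0 ⊗ₜ x) = 0 := fun x => form_ext_left fun s t => by
      rw [altForm_tmul, k0, k0]
      simp
    have a12 : altForm K (b 1 ⊗ₜ b 2) (b 1 ⊗ₜ b 2) = altForm H (b 1 ⊗ₜ b 2) (b 1 ⊗ₜ b 2) := by
      rw [altForm_tmul, altForm_tmul, k12, k11]
    have hKH : ∀ t, altForm H t = 0 → altForm K t = 0 := by
      intro t ht
      obtain ⟨p, q, r, h⟩ := exists_altForm_eq b t
      have h1 := LinearMap.congr_fun (h H hH) (b 1 ⊗ₜ b 2)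
      simp only [ht, hz, smul_zero, zero_add, LinearMap.smul_apply, LinearMap.zero_apply,
        smul_eq_mul] at h1
      rw [h K hK, a0, a0, smul_zero, smul_zero, zero_add, zero_add, ← map_smul]
      refine hK.altForm_apply_eq_zero b ?_ ?_ ?_
      · rw [hK.altForm_symm, a0]; rfl
      · rw [hK.altForm_symm, a0]; rfl
      · rw [map_smul, LinearMap.smul_apply, a12, smul_eq_mul, ← h1]
    obtain ⟨c, hc⟩ := hH.exists_smul_eq hext hK
      (fun t => spanForm_eq_zero_of_apply_eq_zero hH _ _) hKH
    rcases eq_or_ne c 0 with rfl | hc0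
    · rw [zero_smul] at hc
      rw [hc, LinearMap.zero_apply] at k11 k12
      refine b.ne_zero 1 (hD fun x => ?_)
      rw [← b.sum_repr x]
      simp only [Fin.sum_univ_three, TensorProduct.tmul_add, TensorProduct.tmul_smul, map_add,
        map_smul, h10, ← k11, ← k12, smul_zero, add_zero]
    · refine b.ne_zero 0 (hD fun x => ?_)
      have := k0 x
      rw [hc, LinearMap.smul_apply] at this
      exact (smul_eq_zero.1 this).resolve_left hc0
  · rw [LinearIndependent.pair_iff' hz0] at hzy
    push Not at hzy
    obtain ⟨a, rfl⟩ := hzy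
    have ha : a ≠ 0 := by rintro rfl; simp at hy0
    have hzz : H (z ⊗ₜ z) = 0 := by simpa [ha] using hy
    refine hz0 (hD fun x => apply_eq_zero_of_self hH.1 hp ?_)
    rw [hH.swap_right, apply_swap_of_altForm_eq_zero (hz x), hzz, LinearMap.zero_apply]

end AlternatingRankOne

/-! ### Restrictions of rank one -/

section RankOne

variable {V : Type*} [AddCommGroup V] [Module ℝ V]

lemma tensor_tmul (α β : Module.Dual ℝ V) (x y : V) : tensor α β (x ⊗ₜ y) = α x * β y := by
  simp [tensor]

lemma vee_tmul (α β : Module.Dual ℝ V) (x y : V) :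
    vee α β (x ⊗ₜ y) = (1 / 2) * (α x * β y + β x * α y) := by
  simp [vee, tensor_tmul, mul_add]

lemma wedge_tmul (α β : Module.Dual ℝ V) (x y : V) :
    wedge α β (x ⊗ₜ y) = (1 / 2) * (α x * β y - β x * α y) := by
  simp [wedge, tensor_tmul, mul_sub]

lemma tensorSq_apply (φ : Module.Dual ℝ (V ⊗[ℝ] V)) (s t : V ⊗[ℝ] V) :
    tensorSq φ s t = φ s * φ t := rfl

lemma symProd_self (α : Module.Dual ℝ V) : symProd α α α α = tensorSq (tensor α α) := by
  have : ∀ i : Fin 4, ![α, α, α, α] i = α := fun i => by fin_cases i <;> rfl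
  simp only [symProd, this, tensorSq, Finset.sum_const, Finset.card_univ, Fintype.card_perm,
    Fintype.card_fin]
  refine LinearMap.ext fun s => LinearMap.ext fun t => ?_
  simp [Nat.factorial]

lemma exists_dual_basis [FiniteDimensional ℝ V]
    (α : Module.Basis (Fin 3) ℝ (Module.Dual ℝ V)) :
    ∃ b : Module.Basis (Fin 3) ℝ V, ∀ i j, α i (b j) = if i = j then 1 else 0 := by
  refine ⟨α.dualBasis.map (Module.evalEquiv ℝ V).symm, fun i j => ?_⟩
  rw [Module.Basis.map_apply, Module.apply_evalEquiv_symm_apply, Module.Basis.dualBasis_apply_self]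

lemma isSymForm_tensorSq_vee (α β : Module.Dual ℝ V) : IsSymForm (tensorSq (vee α β)) := by
  refine ⟨fun s t => mul_comm _ _, fun x y => LinearMap.ext fun t => ?_⟩
  rw [tensorSq_apply, tensorSq_apply, vee_tmul, vee_tmul]
  ring

lemma altForm_tensorSq_vee (α β : Module.Dual ℝ V) :
    altForm (tensorSq (vee α β)) = tensorSq (wedge α β) := by
  refine form_ext fun x y z w => ?_
  simp only [altForm_tmul, tensorSq_apply, vee_tmul, wedge_tmul]
  ring

lemma wedge_self (α : Module.Dual ℝ V) : tensorSq (wedge α α) = 0 :=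
  form_ext fun x y z w => by simp [tensorSq_apply, wedge]

lemma vee_self (α : Module.Dual ℝ V) : vee α α = tensor α α := by
  simp only [vee]
  module

/-- The elements of `W` whose restriction to `Sym² V` is the square of a product of two one-forms
are those of type (1) and (2). -/
lemma isType1_or_isType2_of_eq {S : LinearMap.BilinForm ℝ (V ⊗[ℝ] V)} {α β : Module.Dual ℝ V}
    (h : S = tensorSq (vee α β) + tensorSq (wedge α β)) (h0 : S ≠ 0) :
    IsType1 S ∨ IsType2 S := by
  by_cases hli : LinearIndependent ℝ ![α, β]
  · exact Or.inr ⟨α, β, hli, h⟩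
  · left
    have hα : α ≠ 0 := by
      rintro rfl
      refine h0 (h.trans (form_ext fun x y z w => ?_))
      simp [tensorSq_apply, vee_tmul, wedge_tmul]
    rw [LinearIndependent.pair_iff' hα] at hli
    push Not at hli
    obtain ⟨c, rfl⟩ := hli
    have hS : S = symProd (Real.sqrt |c| • α) (Real.sqrt |c| • α) (Real.sqrt |c| • α)
        (Real.sqrt |c| • α) := by
      rw [h, symProd_self]
      refine form_ext fun x y z w => ?_
      have h1 := Real.mul_self_sqrt (abs_nonneg c)
      have h2 := abs_mul_abs_self c
      simp only [LinearMap.add_apply, tensorSq_apply, vee_tmul, wedge_tmul, tensor_tmul,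
        LinearMap.smul_apply, smul_eq_mul]
      linear_combination (α x * α y * α z * α w) * (-h2 -
        (Real.sqrt |c| * Real.sqrt |c| + |c|) * h1)
    refine ⟨_, fun hc => h0 ?_, hS⟩
    rw [hS, hc, symProd_self]
    exact form_ext fun x y z w => by simp [tensorSq_apply, tensor_tmul]

/-- If `H` is the square of a quadratic form `φ` and the alternating block is positive
semi-definite, then every `2 × 2` minor of `φ` is nonpositive. Such a `φ` is a product of two linear
forms, up to sign. -/
lemma IsSymForm.isType1_or_isType2 [FiniteDimensional ℝ V] (hV : Module.finrank ℝ V = 3)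
    {H : LinearMap.BilinForm ℝ (V ⊗[ℝ] V)} (hH : IsSymForm H)
    (ha : ∀ t, 0 ≤ altForm H t t) (h0 : liftForm H ≠ 0) {v : V ⊗[ℝ] V}
    (he : ∀ s t, H s t = H s v * H t v) : IsType1 (liftForm H) ∨ IsType2 (liftForm H) := by
  let q : LinearMap.BilinForm ℝ V := (TensorProduct.mk ℝ V V).compr₂ (H v)
  have hq : ∀ x y, q x y = H v (x ⊗ₜ y) := fun x y => rfl
  have hqs : ∀ x y, q x y = q y x := fun x y => hH.swap_right _ _ _
  have hminor : ∀ x y, q x x * q y y ≤ q x y * q x y := by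
    intro x y
    have h := ha (x ⊗ₜ y)
    rw [altForm_tmul, he, he (x ⊗ₜ x), hH.2 y x, hH.1 _ v, hH.1 _ v, hH.1 _ v] at h
    simp only [hq]
    linarith
  obtain ⟨w', hw'⟩ := LinearMap.BilinForm.exists_orthogonal_basis (B := q) ⟨hqs⟩
  let w := w'.reindex (finCongr hV)
  have hw : ∀ i j, i ≠ j → q (w i) (w j) = 0 := by
    intro i j hij
    simp only [w, Module.Basis.reindex_apply]
    exact hw' fun h => hij ((finCongr hV).symm.injective h)
  have hexp : ∀ x y, q x y = ∑ i, q (w i) (w i) * (w.coord i x * w.coord i y) := by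
    intro x y
    conv_lhs => rw [← w.sum_repr x, ← w.sum_repr y]
    simp only [map_sum, map_smul, LinearMap.sum_apply, LinearMap.smul_apply, smul_eq_mul,
      Module.Basis.coord_apply]
    refine Finset.sum_congr rfl fun i _ => ?_
    rw [Finset.sum_eq_single i]
    · ring
    · intro j _ hj
      rw [hw j i hj]; ring
    · simp
  have hprod : ∀ i j, i ≠ j → q (w i) (w i) * q (w j) (w j) ≤ 0 := by
    intro i j hij
    have := hminor (w i) (w j)
    rwa [hw i j hij, mul_zero] at this
  -- a difference of two squares is a product
  have key : ∀ (p n : ℝ) (f g : Module.Dual ℝ V), 0 ≤ p → n ≤ 0 →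
      (∀ x y, q x y = p * (f x * f y) + n * (g x * g y)) →
      IsType1 (liftForm H) ∨ IsType2 (liftForm H) := by
    intro p n f g hp hn h
    have hp' := Real.mul_self_sqrt hp
    have hn' := Real.mul_self_sqrt (neg_nonneg.2 hn)
    refine isType1_or_isType2_of_eq (α := Real.sqrt p • f + Real.sqrt (-n) • g)
      (β := Real.sqrt p • f - Real.sqrt (-n) • g) ?_ h0
    rw [← altForm_tensorSq_vee]
    have : H = tensorSq (vee (Real.sqrt p • f + Real.sqrt (-n) • g)
        (Real.sqrt p • f - Real.sqrt (-n) • g)) := by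
      refine form_ext fun x y z t => ?_
      have h1 : ∀ x y, vee (Real.sqrt p • f + Real.sqrt (-n) • g)
          (Real.sqrt p • f - Real.sqrt (-n) • g) (x ⊗ₜ y) = q x y := by
        intro x y
        rw [h, vee_tmul]
        simp only [LinearMap.add_apply, LinearMap.sub_apply, LinearMap.smul_apply, smul_eq_mul]
        linear_combination (f x * f y) * hp' - (g x * g y) * hn'
      rw [tensorSq_apply, h1, h1, he, hq, hq, hH.1 v, hH.1 v]
    rw [← this, liftForm]
  simp only [Fin.sum_univ_three] at hexp
  have h01 := hprod 0 1 (by decide)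
  have h02 := hprod 0 2 (by decide)
  have h12 := hprod 1 2 (by decide)
  generalize q (w 0) (w 0) = d0 at *
  generalize q (w 1) (w 1) = d1 at *
  generalize q (w 2) (w 2) = d2 at *
  have hzero : d0 = 0 ∨ d1 = 0 ∨ d2 = 0 := by
    by_contra! hne
    have h1 : 0 < (d0 * d1 * d2) ^ 2 := by
      have := mul_ne_zero (mul_ne_zero hne.1 hne.2.1) hne.2.2
      positivity
    nlinarith [mul_nonneg_of_nonpos_of_nonpos h01 h02, mul_nonpos_of_nonneg_of_nonpos
      (mul_nonneg_of_nonpos_of_nonpos h01 h02) h12]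
  have hsign : ∀ a b : ℝ, a * b ≤ 0 → (0 ≤ a ∧ b ≤ 0) ∨ (0 ≤ b ∧ a ≤ 0) := by
    intro a b h
    rcases mul_nonpos_iff.1 h with h | h
    · exact Or.inl h
    · exact Or.inr h.symm
  rcases hzero with rfl | rfl | rfl
  · rcases hsign _ _ h12 with h | h
    · exact key d1 d2 (w.coord 1) (w.coord 2) h.1 h.2 fun x y => by rw [hexp]; ring
    · exact key d2 d1 (w.coord 2) (w.coord 1) h.1 h.2 fun x y => by rw [hexp]; ring
  · rcases hsign _ _ h02 with h | h
    · exact key d0 d2 (w.coord 0) (w.coord 2) h.1 h.2 fun x y => by rw [hexp]; ring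
    · exact key d2 d0 (w.coord 2) (w.coord 0) h.1 h.2 fun x y => by rw [hexp]; ring
  · rcases hsign _ _ h01 with h | h
    · exact key d0 d1 (w.coord 0) (w.coord 1) h.1 h.2 fun x y => by rw [hexp]; ring
    · exact key d1 d0 (w.coord 1) (w.coord 0) h.1 h.2 fun x y => by rw [hexp]; ring

lemma exists_smul_linMulLin_of_ker_le {E : Type*} [AddCommGroup E] [Module ℝ E]
    {φ : Module.Dual ℝ E} (hφ : φ ≠ 0) {T : LinearMap.BilinForm ℝ E}
    (hs : ∀ s t, T s t = T t s) (hk : ∀ t, φ t = 0 → T t = 0) :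
    ∃ c : ℝ, T = c • LinearMap.BilinForm.linMulLin φ φ := by
  obtain ⟨u, hu⟩ : ∃ u, φ u ≠ 0 := by
    by_contra! h
    exact hφ (LinearMap.ext h)
  have h : ∀ t, φ u • T t = φ t • T u := by
    intro t
    have := hk (φ u • t - φ t • u) (by simp [mul_comm])
    rw [map_sub, map_smul, map_smul, sub_eq_zero] at this
    exact this
  refine ⟨T u u / (φ u * φ u), LinearMap.ext fun s => LinearMap.ext fun t => ?_⟩
  have h1 := LinearMap.congr_fun (h s) t
  have h2 := LinearMap.congr_fun (h t) u
  simp only [LinearMap.smul_apply, smul_eq_mul, LinearMap.BilinForm.linMulLin_apply] at h1 h2 ⊢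
  rw [hs t u] at h2
  field_simp
  linear_combination φ u * h1 + φ s * h2

lemma tensorSq_vee_add_mem_CW (α β : Module.Dual ℝ V) :
    tensorSq (vee α β) + tensorSq (wedge α β) ∈ CW V := by
  have h := (isSymForm_tensorSq_vee α β).liftForm_mem_CW_iff
  rw [liftForm, altForm_tensorSq_vee] at h
  exact h.2 ⟨fun t => mul_self_nonneg _, fun t => mul_self_nonneg _⟩

lemma IsType1.isExtremal {S : LinearMap.BilinForm ℝ (V ⊗[ℝ] V)} (h : IsType1 S) :
    IsExtremal (CW V) S := by
  obtain ⟨α, hα, rfl⟩ := h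
  obtain ⟨x, hx⟩ : ∃ x, α x ≠ 0 := by
    by_contra! h
    exact hα (LinearMap.ext h)
  rw [symProd_self]
  have hne : tensor α α ≠ 0 := fun h => by
    have := LinearMap.congr_fun h (x ⊗ₜ x)
    simp [tensor_tmul, hx] at this
  have hmem := tensorSq_vee_add_mem_CW α α
  rw [wedge_self, vee_self, add_zero] at hmem
  refine isExtremal_of_forall (M := W V) (fun T => Iff.rfl) (fun T hT => hT.1) hmem ?_ ?_
  · intro h
    have := LinearMap.congr_fun (LinearMap.congr_fun h (x ⊗ₜ x)) (x ⊗ₜ x)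
    simp [tensorSq_apply, tensor_tmul, hx] at this
  · intro T hT hk
    exact exists_smul_linMulLin_of_ker_le hne hT.1 fun t ht => hk t (LinearMap.ext fun s => by
      rw [tensorSq_apply, ht, zero_mul, LinearMap.zero_apply])

lemma exists_dual_pair (hV : Module.finrank ℝ V = 3) {α β : Module.Dual ℝ V}
    (h : LinearIndependent ℝ ![α, β]) : ∃ e f : V, α e = 1 ∧ α f = 0 ∧ β e = 0 ∧ β f = 1 := by
  have : FiniteDimensional ℝ V := Module.finite_of_finrank_pos (by omega)
  obtain ⟨a, rfl, rfl⟩ := exists_basis_of_pair (by rw [Subspace.dual_finrank_eq, hV]) h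
  obtain ⟨b, hb⟩ := exists_dual_basis a
  exact ⟨b 0, b 1, by simp [hb], by simp [hb], by simp [hb], by simp [hb]⟩

lemma IsType2.isExtremal (hV : Module.finrank ℝ V = 3) {S : LinearMap.BilinForm ℝ (V ⊗[ℝ] V)}
    (h : IsType2 S) : IsExtremal (CW V) S := by
  obtain ⟨α, β, hli, rfl⟩ := h
  obtain ⟨e, f, h1, h2, h3, h4⟩ := exists_dual_pair hV hli
  refine isExtremal_of_forall (M := W V) (fun T => Iff.rfl) (fun T hT => hT.1)
    (tensorSq_vee_add_mem_CW α β) ?_ ?_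
  · intro h
    have := LinearMap.congr_fun (LinearMap.congr_fun h (e ⊗ₜ f)) (e ⊗ₜ f)
    simp [tensorSq_apply, vee_tmul, wedge_tmul, h1, h2, h3, h4] at this
  · intro T hT hk
    have hk' : ∀ t, vee α β t = 0 → wedge α β t = 0 → T t = 0 := fun t ht ht' =>
      hk t (LinearMap.ext fun s => by simp [tensorSq_apply, ht, ht'])
    have hT1 : ∀ t, T t = (vee α β t + wedge α β t) • T (e ⊗ₜ f) +
        (vee α β t - wedge α β t) • T (f ⊗ₜ e) := by
      intro t
      have := hk' (t - ((vee α β t + wedge α β t) • (e ⊗ₜ f) +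
        (vee α β t - wedge α β t) • (f ⊗ₜ e)))
        (by simp [vee_tmul, h1, h2, h3, h4]; ring) (by simp [wedge_tmul, h1, h2, h3, h4]; ring)
      rw [map_sub, sub_eq_zero, map_add, map_smul, map_smul] at this
      exact this
    have hee : T (e ⊗ₜ e) = 0 := hk' _ (by simp [vee_tmul, h3]) (by simp [wedge_tmul, h3])
    have e1 : T (e ⊗ₜ f) (f ⊗ₜ e) = 0 := by
      rw [hT.2.2, hee, LinearMap.zero_apply]
    have e2 : T (f ⊗ₜ e) (f ⊗ₜ e) = T (e ⊗ₜ f) (e ⊗ₜ f) := by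
      simpa using W.comm_comm hT (e ⊗ₜ f) (e ⊗ₜ f)
    refine ⟨2 * T (e ⊗ₜ f) (e ⊗ₜ f), LinearMap.ext fun s => LinearMap.ext fun t => ?_⟩
    have e3 : T (e ⊗ₜ f) t = (vee α β t + wedge α β t) * T (e ⊗ₜ f) (e ⊗ₜ f) := by
      rw [hT.1, hT1]
      simp [hT.1 (f ⊗ₜ[ℝ] e) (e ⊗ₜ[ℝ] f), e1]
    have e4 : T (f ⊗ₜ e) t = (vee α β t - wedge α β t) * T (e ⊗ₜ f) (e ⊗ₜ f) := by
      rw [hT.1, hT1]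
      simp [e2, e1]
    rw [hT1]
    simp only [LinearMap.add_apply, LinearMap.smul_apply, smul_eq_mul, e3, e4, tensorSq_apply]
    ring

/-- A restriction `R(S)` of rank one is extremal in `C_Sym`. -/
lemma isExtremal_R_of_eq {S : LinearMap.BilinForm ℝ (V ⊗[ℝ] V)} {φ : Module.Dual ℝ (V ⊗[ℝ] V)}
    (h : ∀ s ∈ SymSq V, ∀ t ∈ SymSq V, S s t = φ s * φ t) {u : V ⊗[ℝ] V} (hu : u ∈ SymSq V)
    (hφ : φ u ≠ 0) : IsExtremal (CSym V) (R S) := by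
  let M : Submodule ℝ (LinearMap.BilinForm ℝ (SymSq V)) :=
    { carrier := {T | ∀ s t, T s t = T t s}
      zero_mem' := fun s t => rfl
      add_mem' := fun hS hT s t => by simp only [LinearMap.add_apply, hS s t, hT s t]
      smul_mem' := fun c T hT s t => by simp only [LinearMap.smul_apply, hT s t] }
  let φ' : Module.Dual ℝ (SymSq V) := φ ∘ₗ (SymSq V).subtype
  have hR : R S = LinearMap.BilinForm.linMulLin φ' φ' :=
    LinearMap.ext fun s => LinearMap.ext fun t => h s s.2 t t.2
  have hφ' : φ' ≠ 0 := fun h0 => hφ (LinearMap.congr_fun h0 ⟨u, hu⟩)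
  rw [hR]
  refine isExtremal_of_forall (M := M) (fun T => Iff.rfl) (fun T hT => hT)
    ⟨fun s t => mul_comm _ _, fun t => mul_self_nonneg _⟩ (fun h0 => ?_) fun T hT hk => ?_
  · have := LinearMap.congr_fun (LinearMap.congr_fun h0 ⟨u, hu⟩) ⟨u, hu⟩
    exact hφ (mul_self_eq_zero.1 this)
  · exact exists_smul_linMulLin_of_ker_le hφ' hT fun t ht => hk t (LinearMap.ext fun s => by
      rw [LinearMap.BilinForm.linMulLin_apply, ht, zero_mul, LinearMap.zero_apply])

lemma IsType1.isExtremal_R {S : LinearMap.BilinForm ℝ (V ⊗[ℝ] V)} (h : IsType1 S) :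
    IsExtremal (CSym V) (R S) := by
  obtain ⟨α, hα, rfl⟩ := h
  obtain ⟨x, hx⟩ : ∃ x, α x ≠ 0 := by
    by_contra! h
    exact hα (LinearMap.ext h)
  refine isExtremal_R_of_eq (φ := tensor α α) (fun s _ t _ => by rw [symProd_self]; rfl)
    (u := x ⊗ₜ x) (by simp [SymSq]) (by simp [tensor_tmul, hx])

lemma IsType2.isExtremal_R (hV : Module.finrank ℝ V = 3)
    {S : LinearMap.BilinForm ℝ (V ⊗[ℝ] V)} (h : IsType2 S) : IsExtremal (CSym V) (R S) := by
  obtain ⟨α, β, hli, rfl⟩ := h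
  obtain ⟨e, f, h1, h2, h3, h4⟩ := exists_dual_pair hV hli
  have hw : ∀ s ∈ SymSq V, wedge α β s = 0 := by
    intro s hs
    have hs' : TensorProduct.comm ℝ V V s = s := sub_eq_zero.1 hs
    have hc : wedge α β ∘ₗ (TensorProduct.comm ℝ V V).toLinearMap = - wedge α β :=
      form_ext_left fun x y => by
        simp only [LinearMap.comp_apply, LinearEquiv.coe_coe, TensorProduct.comm_tmul,
          LinearMap.neg_apply, wedge_tmul]
        ring
    have := LinearMap.congr_fun hc s
    simp only [LinearMap.comp_apply, LinearEquiv.coe_coe, hs', LinearMap.neg_apply] at this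
    linarith
  refine isExtremal_R_of_eq (φ := vee α β) (fun s hs t _ => ?_)
    (u := e ⊗ₜ f + f ⊗ₜ e) (by simp [SymSq, add_comm]) (by simp [vee_tmul, h1, h2, h3, h4])
  rw [LinearMap.add_apply, LinearMap.add_apply, tensorSq_apply, tensorSq_apply, hw s hs]
  ring

end RankOne

/-! ### Totally symmetric tensors -/

section TotallySymmetric

variable {V : Type*} [AddCommGroup V] [Module ℝ V]

lemma symProd_tmul (β : Fin 4 → Module.Dual ℝ V) (x : Fin 4 → V) :
    symProd (β 0) (β 1) (β 2) (β 3) (x 0 ⊗ₜ x 1) (x 2 ⊗ₜ x 3) =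
      (1 / 24) * ∑ σ : Equiv.Perm (Fin 4), ∏ i, β (σ i) (x i) := by
  have hβ : ![β 0, β 1, β 2, β 3] = β := by ext i; fin_cases i <;> rfl
  rw [symProd, hβ]
  simp only [LinearMap.smul_apply, LinearMap.sum_apply, LinearMap.BilinForm.linMulLin_apply,
    tensor_tmul, smul_eq_mul, Fin.prod_univ_four]
  congr 1
  exact Finset.sum_congr rfl fun σ _ => by ring

lemma symProd_perm (β : Fin 4 → Module.Dual ℝ V) (x : Fin 4 → V) (ρ : Equiv.Perm (Fin 4)) :
    symProd (β 0) (β 1) (β 2) (β 3) (x (ρ 0) ⊗ₜ x (ρ 1)) (x (ρ 2) ⊗ₜ x (ρ 3)) =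
      symProd (β 0) (β 1) (β 2) (β 3) (x 0 ⊗ₜ x 1) (x 2 ⊗ₜ x 3) := by
  rw [symProd_tmul, symProd_tmul β (fun i => x (ρ i))]
  congr 1
  rw [← Equiv.sum_comp (Equiv.mulRight ρ)]
  refine Finset.sum_congr rfl fun σ _ => ?_
  rw [← Equiv.prod_comp ρ (fun i => β (σ i) (x i))]
  rfl

lemma symProd_diag (β₁ β₂ β₃ β₄ : Module.Dual ℝ V) (x : V) :
    symProd β₁ β₂ β₃ β₄ (x ⊗ₜ x) (x ⊗ₜ x) = β₁ x * β₂ x * β₃ x * β₄ x := by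
  have h := symProd_tmul ![β₁, β₂, β₃, β₄] fun _ => x
  have h1 : ∀ σ : Equiv.Perm (Fin 4), ∏ i, (![β₁, β₂, β₃, β₄] (σ i)) x =
      β₁ x * β₂ x * β₃ x * β₄ x := fun σ => by
    rw [Equiv.prod_comp σ (fun i => (![β₁, β₂, β₃, β₄] i) x), Fin.prod_univ_four]
    rfl
  simp only [h1, Finset.sum_const, Finset.card_univ, Fintype.card_perm, Fintype.card_fin] at h
  refine h.trans ?_
  simp [Nat.factorial]

variable (β₁ β₂ β₃ β₄ : Module.Dual ℝ V) (x y z w : V)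

lemma symProd_swap₁₂ : symProd β₁ β₂ β₃ β₄ (x ⊗ₜ y) (z ⊗ₜ w) =
    symProd β₁ β₂ β₃ β₄ (y ⊗ₜ x) (z ⊗ₜ w) :=
  symProd_perm ![β₁, β₂, β₃, β₄] ![y, x, z, w] (Equiv.swap 0 1)

lemma symProd_swap₂₄ : symProd β₁ β₂ β₃ β₄ (x ⊗ₜ y) (z ⊗ₜ w) =
    symProd β₁ β₂ β₃ β₄ (x ⊗ₜ w) (z ⊗ₜ y) :=
  symProd_perm ![β₁, β₂, β₃, β₄] ![x, w, z, y] (Equiv.swap 1 3)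

lemma symProd_swap₁₃ : symProd β₁ β₂ β₃ β₄ (x ⊗ₜ y) (z ⊗ₜ w) =
    symProd β₁ β₂ β₃ β₄ (z ⊗ₜ y) (x ⊗ₜ w) :=
  symProd_perm ![β₁, β₂, β₃, β₄] ![z, y, x, w] (Equiv.swap 0 2)

lemma symProd_symm : symProd β₁ β₂ β₃ β₄ (x ⊗ₜ y) (z ⊗ₜ w) =
    symProd β₁ β₂ β₃ β₄ (z ⊗ₜ w) (x ⊗ₜ y) := by
  rw [symProd_swap₁₃, symProd_swap₂₄]

lemma symProd_mem_W : symProd β₁ β₂ β₃ β₄ ∈ W V := by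
  have hs : IsSymForm (symProd β₁ β₂ β₃ β₄) :=
    ⟨form_symm (symProd_symm β₁ β₂ β₃ β₄), fun x y => form_ext_left fun z w =>
      symProd_swap₁₂ β₁ β₂ β₃ β₄ x y z w⟩
  have ha : altForm (symProd β₁ β₂ β₃ β₄) = 0 := form_ext fun x y z w => by
    rw [altForm_tmul, symProd_swap₂₄, hs.swap_right (x ⊗ₜ z), sub_self]
    rfl
  have := hs.liftForm_mem_W
  rwa [liftForm, ha, add_zero] at this

/-- An element of `W` is determined by the associated quartic form and by its antisymmetrisation in
the first two arguments. -/
lemma eq_of_mem_W {S T : LinearMap.BilinForm ℝ (V ⊗[ℝ] V)} (hS : S ∈ W V) (hT : T ∈ W V)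
    (h1 : ∀ x y z w, S (x ⊗ₜ y) (z ⊗ₜ w) - S (y ⊗ₜ x) (z ⊗ₜ w) =
      T (x ⊗ₜ y) (z ⊗ₜ w) - T (y ⊗ₜ x) (z ⊗ₜ w))
    (h2 : ∀ x, S (x ⊗ₜ x) (x ⊗ₜ x) = T (x ⊗ₜ x) (x ⊗ₜ x)) : S = T := by
  let D : V → V → V → V → ℝ := fun x y z w => S (x ⊗ₜ y) (z ⊗ₜ w) - T (x ⊗ₜ y) (z ⊗ₜ w)
  have d12 : ∀ x y z w, D x y z w = D y x z w := fun x y z w => by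
    simp only [D]; linarith [h1 x y z w]
  have d24 : ∀ x y z w, D x y z w = D x w z y := fun x y z w => by
    simp only [D]; rw [hS.2.2, hT.2.2]
  have dsym : ∀ x y z w, D x y z w = D z w x y := fun x y z w => by
    simp only [D]; rw [hS.1, hT.1]
  have d14 : ∀ x y z w, D x y z w = D w y z x := fun x y z w => by
    rw [d12, d24, d12]
  have dadd : ∀ x x' y z w, D (x + x') y z w = D x y z w + D x' y z w := fun x x' y z w => by
    simp only [D, TensorProduct.add_tmul, map_add, LinearMap.add_apply]; ring
  have dneg : ∀ x y z w, D (-x) y z w = - D x y z w := fun x y z w => by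
    simp only [D, TensorProduct.neg_tmul, map_neg, LinearMap.neg_apply]; ring
  have dadd2 : ∀ x y y' z w, D x (y + y') z w = D x y z w + D x y' z w := fun x y y' z w => by
    rw [d12, dadd, d12 y, d12 y']
  have dadd4 : ∀ x y z w w', D x y z (w + w') = D x y z w + D x y z w' := fun x y z w w' => by
    rw [d14, dadd, d14 w, d14 w']
  have dadd3 : ∀ x y z z' w, D x y (z + z') w = D x y z w + D x y z' w := fun x y z z' w => by
    rw [dsym, dadd, dsym z, dsym z']
  have dneg2 : ∀ x y z w, D x (-y) z w = - D x y z w := fun x y z w => by rw [d12, dneg, d12 y]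
  have dneg3 : ∀ x y z w, D x y (-z) w = - D x y z w := fun x y z w => by rw [dsym, dneg, dsym z]
  have dneg4 : ∀ x y z w, D x y z (-w) = - D x y z w := fun x y z w => by rw [d14, dneg, d14 w]
  have dq : ∀ x, D x x x x = 0 := fun x => sub_eq_zero.2 (h2 x)
  have d1 : ∀ x y, D x x y y = 0 := by
    intro x y
    have e1 := dq (x + y)
    have e2 := dq (x + -y)
    simp only [dadd, dadd2, dadd3, dadd4, dneg, dneg2, dneg3, dneg4, dq] at e1 e2
    have f1 : D x y x y = D x x y y := by rw [d14, dsym]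
    have f2 : D x y y x = D x x y y := by rw [d24]
    have f3 : D y x x y = D x x y y := by rw [d12, f1]
    have f4 : D y x y x = D x x y y := by rw [d12, f2]
    have f5 : D y y x x = D x x y y := by rw [dsym]
    linarith
  have d2 : ∀ x y w, D x x y w = 0 := by
    intro x y w
    have e1 := d1 x (y + w)
    simp only [dadd3, dadd4, d1] at e1
    have f1 : D x x w y = D x x y w := by rw [dsym, d12, dsym]
    linarith
  have d3 : ∀ x z y w, D x z y w = 0 := by
    intro x z y w
    have e1 := d2 (x + z) y w
    simp only [dadd, dadd2, d2] at e1
    linarith [d12 x z y w]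
  exact form_ext fun x y z w => sub_eq_zero.1 (d3 x y z w)

end TotallySymmetric

/-! ### The third family as a sum of three squares -/

section ThirdFamily

variable {V : Type*} [AddCommGroup V] [Module ℝ V]

/-- The three quadratic forms on `V` whose squares add up to the restriction to `Sym² V` of the
third family. -/
noncomputable def net (α : Fin 3 → Module.Dual ℝ V) (g d h : ℝ) :
    Fin 3 → Module.Dual ℝ (V ⊗[ℝ] V) :=
  ![vee (α 0) (α 0) + vee (α 1) (α 1) + vee (α 2) (α 2),
    (2 : ℝ) • vee (α 0) (α 1) + (2 * d) • vee (α 1) (α 2) + g • vee (α 2) (α 2),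
    (2 : ℝ) • vee (α 0) (α 2) + d • vee (α 1) (α 1) + (2 * g) • vee (α 1) (α 2) +
      h • vee (α 2) (α 2)]

/-- The sum of the squares of the quadratic forms in `net`. -/
noncomputable def netForm (α : Fin 3 → Module.Dual ℝ V) (g d h : ℝ) :
    LinearMap.BilinForm ℝ (V ⊗[ℝ] V) :=
  ∑ i, tensorSq (net α g d h i)

variable (α : Fin 3 → Module.Dual ℝ V) (g d h : ℝ)

lemma net_zero_tmul (x y : V) : net α g d h 0 (x ⊗ₜ y) =
    α 0 x * α 0 y + α 1 x * α 1 y + α 2 x * α 2 y := by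
  simp only [net, Matrix.cons_val, LinearMap.add_apply, vee_tmul]
  ring

lemma net_one_tmul (x y : V) : net α g d h 1 (x ⊗ₜ y) =
    (α 0 x * α 1 y + α 1 x * α 0 y) + d * (α 1 x * α 2 y + α 2 x * α 1 y) +
      g * (α 2 x * α 2 y) := by
  simp only [net, Matrix.cons_val, LinearMap.add_apply, LinearMap.smul_apply, smul_eq_mul,
    vee_tmul]
  ring

lemma net_two_tmul (x y : V) : net α g d h 2 (x ⊗ₜ y) =
    (α 0 x * α 2 y + α 2 x * α 0 y) + d * (α 1 x * α 1 y) +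
      g * (α 1 x * α 2 y + α 2 x * α 1 y) + h * (α 2 x * α 2 y) := by
  simp only [net, Matrix.cons_val, LinearMap.add_apply, LinearMap.smul_apply, smul_eq_mul,
    vee_tmul]
  ring

lemma netForm_apply (s t : V ⊗[ℝ] V) :
    netForm α g d h s t = ∑ i, net α g d h i s * net α g d h i t := by
  simp [netForm, LinearMap.sum_apply, tensorSq_apply]

lemma isSymForm_netForm : IsSymForm (netForm α g d h) := by
  refine ⟨fun s t => ?_, fun x y => LinearMap.ext fun t => ?_⟩
  · simp only [netForm_apply, mul_comm]
  · simp only [netForm_apply, Fin.sum_univ_three, net_zero_tmul, net_one_tmul, net_two_tmul]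
    ring

lemma altForm_netForm : altForm (netForm α g d h) =
    (4 * (g ^ 2 + d ^ 2 - 1 - d * h)) • tensorSq (wedge (α 1) (α 2)) := by
  refine form_ext fun x y z w => ?_
  simp only [altForm_tmul, netForm_apply, Fin.sum_univ_three, net_zero_tmul, net_one_tmul,
    net_two_tmul, LinearMap.smul_apply, smul_eq_mul, tensorSq_apply, wedge_tmul]
  ring

lemma tensorSq_add_mem_W (β γ : Module.Dual ℝ V) :
    tensorSq (tensor β γ) + tensorSq (tensor γ β) ∈ W V := by
  have h := (W V).smul_mem (2 : ℝ) (tensorSq_vee_add_mem_CW β γ).1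
  have e : (2 : ℝ) • (tensorSq (vee β γ) + tensorSq (wedge β γ)) =
      tensorSq (tensor β γ) + tensorSq (tensor γ β) := by
    refine form_ext fun x y z w => ?_
    simp only [LinearMap.smul_apply, LinearMap.add_apply, smul_eq_mul, tensorSq_apply, vee_tmul,
      wedge_tmul, tensor_tmul]
    ring
  rwa [e] at h

lemma Stot_mem_W (α₁ α₂ α₃ : Module.Dual ℝ V) : Stot α₁ α₂ α₃ g d h ∈ W V := by
  unfold Stot
  have hm := fun c β₁ β₂ β₃ β₄ => (W V).smul_mem (c : ℝ) (symProd_mem_W (V := V) β₁ β₂ β₃ β₄)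
  repeat' apply (W V).add_mem
  all_goals first | exact symProd_mem_W _ _ _ _ | exact hm _ _ _ _ _

/-- The tensors of the third family are those with restriction `netForm` to `Sym² V`. -/
lemma liftForm_netForm : liftForm (netForm α g d h) = Stot (α 0) (α 1) (α 2) g d h +
    (2 * (g ^ 2 + d ^ 2 - 1 - d * h)) •
      (tensorSq (tensor (α 1) (α 2)) + tensorSq (tensor (α 2) (α 1))) := by
  refine eq_of_mem_W (isSymForm_netForm α g d h).liftForm_mem_W
    ((W V).add_mem (Stot_mem_W g d h _ _ _) ((W V).smul_mem _ (tensorSq_add_mem_W _ _)))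
    (fun x y z w => ?_) fun x => ?_
  · have hsym := isSymForm_netForm α g d h
    have e1 : liftForm (netForm α g d h) (x ⊗ₜ y) (z ⊗ₜ w) -
        liftForm (netForm α g d h) (y ⊗ₜ x) (z ⊗ₜ w) =
          2 * altForm (netForm α g d h) (x ⊗ₜ y) (z ⊗ₜ w) := by
      simp only [liftForm, LinearMap.add_apply]
      rw [hsym.2 y x, hsym.altForm_swap y x, LinearMap.neg_apply]
      ring
    have e2 : Stot (α 0) (α 1) (α 2) g d h (x ⊗ₜ y) (z ⊗ₜ w) =
        Stot (α 0) (α 1) (α 2) g d h (y ⊗ₜ x) (z ⊗ₜ w) := by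
      simp only [Stot, LinearMap.add_apply, LinearMap.smul_apply, symProd_swap₁₂ _ _ _ _ x y z w]
    rw [e1, altForm_netForm]
    simp only [LinearMap.add_apply, LinearMap.smul_apply, smul_eq_mul, e2, tensorSq_apply,
      tensor_tmul, wedge_tmul]
    ring
  · simp only [liftForm_tmul, Stot, LinearMap.add_apply, LinearMap.smul_apply, smul_eq_mul,
      symProd_diag, tensorSq_apply, tensor_tmul, netForm_apply, Fin.sum_univ_three, net_zero_tmul,
      net_one_tmul, net_two_tmul]
    ring

lemma isType3_iff {S : LinearMap.BilinForm ℝ (V ⊗[ℝ] V)} :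
    IsType3 S ↔ ∃ (α : Module.Basis (Fin 3) ℝ (Module.Dual ℝ V)) (g d h : ℝ),
      0 < g ^ 2 + d ^ 2 - 1 - d * h ∧ S = liftForm (netForm α g d h) := by
  constructor
  · rintro ⟨α, g, d, h, h1, h2⟩
    exact ⟨α, g, d, h, by linarith, by rw [liftForm_netForm, h2]⟩
  · rintro ⟨α, g, d, h, h1, h2⟩
    exact ⟨α, g, d, h, by linarith, by rw [h2, liftForm_netForm]⟩

end ThirdFamily

/-! ### Adapted bases -/

section Adapted

variable {V : Type*} [AddCommGroup V] [Module ℝ V]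

/-- A basis adapted to `H`: the tensors `b₀ ∨ bᵢ` are orthonormal for `H` and span a complement of
its kernel in `Sym² V`, and `b₀ ∧ V` lies in the kernel of the alternating block. -/
structure IsAdapted (H : LinearMap.BilinForm ℝ (V ⊗[ℝ] V)) (b : Module.Basis (Fin 3) ℝ V) :
    Prop where
  orthonormal : ∀ i j, H (b 0 ⊗ₜ b i) (b 0 ⊗ₜ b j) = if i = j then 1 else 0
  expansion : ∀ s t, H s t = ∑ i, H s (b 0 ⊗ₜ b i) * H t (b 0 ⊗ₜ b i)
  alternating : ∀ x, altForm H (b 0 ⊗ₜ x) = 0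

variable {H : LinearMap.BilinForm ℝ (V ⊗[ℝ] V)} {b : Module.Basis (Fin 3) ℝ V}

lemma IsSymForm.apply_eq_zero_of_mem_AltSq (hH : IsSymForm H) {s : V ⊗[ℝ] V} (hs : s ∈ AltSq V) :
    H s = 0 := by
  have h1 : TensorProduct.comm ℝ V V s = -s := eq_neg_of_add_eq_zero_left hs
  have h2 := hH.comm_left s
  rw [h1, map_neg] at h2
  refine LinearMap.ext fun t => ?_
  have h3 := LinearMap.congr_fun h2 t
  rw [LinearMap.neg_apply] at h3
  rw [LinearMap.zero_apply]
  linarith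

lemma IsSymForm.altForm_eq_zero_of_mem_SymSq (hH : IsSymForm H) {s : V ⊗[ℝ] V}
    (hs : s ∈ SymSq V) : altForm H s = 0 := by
  have h1 : TensorProduct.comm ℝ V V s = s := sub_eq_zero.1 hs
  have h2 := hH.altForm_comm s
  rw [h1] at h2
  refine LinearMap.ext fun t => ?_
  have h3 := LinearMap.congr_fun h2 t
  rw [LinearMap.neg_apply] at h3
  rw [LinearMap.zero_apply]
  linarith

lemma IsSymForm.R_liftForm_apply (hH : IsSymForm H) (s t : SymSq V) :
    R (liftForm H) s t = H s t := by
  change liftForm H s t = H s t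
  rw [liftForm, LinearMap.add_apply, hH.altForm_eq_zero_of_mem_SymSq s.2, add_zero]

lemma IsSymForm.R'_liftForm_apply (hH : IsSymForm H) (s t : AltSq V) :
    R' (liftForm H) s t = altForm H s t := by
  change liftForm H s t = altForm H s t
  rw [liftForm, LinearMap.add_apply, hH.apply_eq_zero_of_mem_AltSq s.2, zero_add]

lemma IsSymForm.formRank_R_liftForm [FiniteDimensional ℝ V] (hH : IsSymForm H) {n : ℕ}
    {v : Fin n → V ⊗[ℝ] V} (hv : ∀ i j, H (v i) (v j) = if i = j then 1 else 0)
    (he : ∀ x y, H x y = ∑ i, H x (v i) * H y (v i)) : formRank (R (liftForm H)) = n := by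
  let v' : Fin n → SymSq V := fun i =>
    ⟨(1 / 2 : ℝ) • (v i + TensorProduct.comm ℝ V V (v i)), by simp [SymSq, add_comm]⟩
  have hv' : ∀ i, H (v' i : V ⊗[ℝ] V) = H (v i) := by
    intro i
    simp only [v', map_smul, map_add, hH.comm_left]
    module
  have hv'' : ∀ s i, H s (v' i : V ⊗[ℝ] V) = H s (v i) := fun s i => by
    rw [hH.1, hv', hH.1]
  refine formRank_eq_of_expansion (v := v') (fun i j => ?_) fun s t => ?_
  · rw [hH.R_liftForm_apply, hv', hv'', hv]
  · simp only [hH.R_liftForm_apply, hv'', he s t]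

lemma tmul_add_tmul_eq_zero {z v : V} (hz : z ≠ 0)
    (h : z ⊗ₜ[ℝ] v + v ⊗ₜ[ℝ] z = 0) : v = 0 := by
  obtain ⟨f, hf⟩ : ∃ f : Module.Dual ℝ V, f z ≠ 0 := by
    by_contra! hcon
    exact hz ((Module.forall_dual_apply_eq_zero_iff ℝ z).1 hcon)
  have h1 := congrArg (TensorProduct.lift ((LinearMap.lsmul ℝ V).comp f)) h
  simp only [map_add, TensorProduct.lift.tmul, LinearMap.comp_apply, LinearMap.lsmul_apply,
    map_zero] at h1
  have h2 := congrArg f h1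
  simp only [map_add, map_smul, smul_eq_mul, map_zero] at h2
  have h3 : f z * f v = 0 := by linarith
  rw [(mul_eq_zero.1 h3).resolve_left hf, zero_smul, add_zero] at h1
  exact (smul_eq_zero.1 h1).resolve_left hf

namespace IsAdapted

variable (hb : IsAdapted H b) (hH : IsSymForm H)
include hb hH

omit hH in
lemma apply_swap (x y z : V) : H (b 0 ⊗ₜ x) (y ⊗ₜ z) = H (b 0 ⊗ₜ z) (y ⊗ₜ x) :=
  apply_swap_of_altForm_eq_zero (hb.alternating _) _ _

lemma altForm_eq_zero (h12 : altForm H (b 1 ⊗ₜ b 2) (b 1 ⊗ₜ b 2) = 0) :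
    altForm H = 0 := by
  have h1 : altForm H (b 1 ⊗ₜ b 2) = 0 := by
    refine hH.altForm_apply_eq_zero b ?_ ?_ h12 <;>
    rw [hH.altForm_symm, hb.alternating] <;> rfl
  refine LinearMap.ext fun t => ?_
  obtain ⟨p, q, r, h⟩ := exists_altForm_eq b t
  rw [h H hH, hb.alternating, hb.alternating, h1]
  simp

/-- Condition `(∗)` in an adapted basis. -/
lemma hasInelasticRanks [FiniteDimensional ℝ V]
    (h12 : 0 < altForm H (b 1 ⊗ₜ b 2) (b 1 ⊗ₜ b 2)) : HasInelasticRanks (liftForm H) := by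
  set κ := altForm H (b 1 ⊗ₜ b 2) (b 1 ⊗ₜ b 2) with hκ
  have halt : ∀ t, ∃ p q r : ℝ, t - TensorProduct.comm ℝ V V t = p • (b 0 ⊗ₜ b 1 - b 1 ⊗ₜ b 0) +
      q • (b 0 ⊗ₜ b 2 - b 2 ⊗ₜ b 0) + r • (b 1 ⊗ₜ b 2 - b 2 ⊗ₜ b 1) ∧
      altForm H t = r • altForm H (b 1 ⊗ₜ b 2) := by
    intro t
    obtain ⟨p, q, r, h⟩ := exists_sub_comm_eq b t
    refine ⟨p, q, r, h, LinearMap.ext fun s => ?_⟩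
    have h1 := LinearMap.congr_fun (congrArg (altForm H) h) s
    simp only [map_sub, map_add, map_smul, hH.altForm_comm, hH.altForm_swap _ (b 0),
      hH.altForm_swap (b 2) (b 1), hb.alternating, LinearMap.sub_apply, LinearMap.zero_apply,
      LinearMap.add_apply, LinearMap.smul_apply, LinearMap.neg_apply, smul_eq_mul] at h1 ⊢
    linarith
  refine ⟨?_, hH.formRank_R_liftForm hb.orthonormal hb.expansion, b 0, b.ne_zero 0, ?_, ?_⟩
  -- a unit vector for the alternating block
  · let u : AltSq V := ⟨(1 / (2 * Real.sqrt κ)) • (b 1 ⊗ₜ b 2 - b 2 ⊗ₜ b 1), by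
      simp [AltSq]⟩
    have hu : ∀ s, altForm H s u = (1 / Real.sqrt κ) * altForm H s (b 1 ⊗ₜ b 2) := by
      intro s
      simp only [u, map_smul, map_sub, hH.altForm_swap_right s (b 2) (b 1), smul_eq_mul]
      field_simp
      ring
    have hsq : Real.sqrt κ * Real.sqrt κ = κ := Real.mul_self_sqrt h12.le
    have hs0 : Real.sqrt κ ≠ 0 := (Real.sqrt_pos.2 h12).ne'
    refine formRank_eq_of_expansion (v := fun _ : Fin 1 => u) (fun i j => ?_) fun s t => ?_
    · rw [hH.R'_liftForm_apply, hu, hH.altForm_symm, hu, ← hκ, Subsingleton.elim i j, if_pos rfl]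
      field_simp
      rw [sq, hsq]
    · obtain ⟨p, q, r, -, h1⟩ := halt s
      obtain ⟨p', q', r', -, h2⟩ := halt t
      simp only [hH.R'_liftForm_apply, hu, Fin.sum_univ_one]
      rw [h1, h2, LinearMap.smul_apply, LinearMap.smul_apply, LinearMap.smul_apply,
        hH.altForm_symm _ (t : V ⊗[ℝ] V), h2, LinearMap.smul_apply, ← hκ]
      simp only [smul_eq_mul]
      field_simp
      rw [sq, hsq]
  · ext s
    simp only [Submodule.mem_map, LinearMap.mem_ker, Submodule.subtype_apply, wedgeSpace,
      LinearMap.mem_range, LinearMap.smul_apply, LinearMap.sub_apply, TensorProduct.mk_apply,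
      LinearMap.flip_apply]
    constructor
    · rintro ⟨s, hs, rfl⟩
      obtain ⟨p, q, r, h, h1⟩ := halt s
      have h2 : TensorProduct.comm ℝ V V s = -(s : V ⊗[ℝ] V) := eq_neg_of_add_eq_zero_left s.2
      have hr : r = 0 := by
        have h3 := LinearMap.congr_fun hs ⟨b 1 ⊗ₜ b 2 - b 2 ⊗ₜ b 1, by simp [AltSq]⟩
        rw [hH.R'_liftForm_apply, h1] at h3
        simp only [LinearMap.smul_apply, map_sub, hH.altForm_swap_right _ (b 2) (b 1), ← hκ,
          LinearMap.zero_apply, smul_eq_mul] at h3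
        have : r * κ = 0 := by linarith
        exact (mul_eq_zero.1 this).resolve_right h12.ne'
      refine ⟨p • b 1 + q • b 2, ?_⟩
      rw [h2, hr] at h
      have h4 : (s : V ⊗[ℝ] V) = (1 / 2 : ℝ) • ((s : V ⊗[ℝ] V) - -(s : V ⊗[ℝ] V)) := by module
      rw [h4, h]
      simp only [TensorProduct.add_tmul, TensorProduct.tmul_add, ← TensorProduct.smul_tmul',
        TensorProduct.tmul_smul]
      module
    · rintro ⟨x, rfl⟩
      refine ⟨⟨(1 / 2 : ℝ) • (b 0 ⊗ₜ x - x ⊗ₜ b 0), by simp [AltSq]⟩, ?_, rfl⟩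
      refine LinearMap.ext fun t => ?_
      rw [hH.R'_liftForm_apply]
      simp only [map_smul, map_sub, hb.alternating, hH.altForm_swap x (b 0)]
      simp
  · rw [eq_bot_iff]
    rintro _ ⟨h1, x, rfl⟩
    simp only [LinearMap.smul_apply, LinearMap.add_apply, TensorProduct.mk_apply,
      LinearMap.flip_apply, SetLike.mem_coe, LinearMap.mem_ker] at h1 ⊢
    have h2 : H (b 0 ⊗ₜ x) = 0 := by
      rw [← h1, liftForm]
      simp only [LinearMap.add_apply, map_smul, map_add, hb.alternating, hH.altForm_swap x (b 0),
        hH.2 x (b 0)]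
      module
    have hx : x = 0 := by
      refine b.ext_elem fun j => ?_
      have h3 := LinearMap.congr_fun h2 (b 0 ⊗ₜ b j)
      conv_lhs at h3 => rw [← b.sum_repr x]
      simp only [TensorProduct.tmul_sum, TensorProduct.tmul_smul, map_sum, map_smul,
        LinearMap.sum_apply, LinearMap.smul_apply, smul_eq_mul, hb.orthonormal] at h3
      simpa using h3
    simp [hx]

end IsAdapted

/-- The three quadratic forms of the third family are the images under `H` of `b₀ ∨ bᵢ`. -/
lemma isAdapted_netForm {α : Fin 3 → Module.Dual ℝ V}
    (hα : ∀ i j, α i (b j) = if i = j then 1 else 0) (g d h : ℝ) :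
    IsAdapted (netForm α g d h) b := by
  have key : ∀ i j, net α g d h j (b 0 ⊗ₜ b i) = if i = j then 1 else 0 := by
    intro i j
    fin_cases j <;> fin_cases i <;>
    simp [net_zero_tmul, net_one_tmul, net_two_tmul, hα]
  have key' : ∀ s i, netForm α g d h s (b 0 ⊗ₜ b i) = net α g d h i s := by
    intro s i
    simp [netForm_apply, key]
  refine ⟨fun i j => ?_, fun s t => ?_, fun x => ?_⟩
  · rw [key', key]
  · rw [netForm_apply]
    simp only [key']
  · rw [altForm_netForm]
    refine form_ext_left fun z w => ?_
    simp [tensorSq_apply, wedge_tmul, hα]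

lemma netForm_mem_CW {α : Fin 3 → Module.Dual ℝ V} {g d h : ℝ}
    (hκ : 0 < g ^ 2 + d ^ 2 - 1 - d * h) : liftForm (netForm α g d h) ∈ CW V := by
  rw [(isSymForm_netForm α g d h).liftForm_mem_CW_iff, altForm_netForm]
  refine ⟨fun t => ?_, fun t => ?_⟩
  · rw [netForm_apply]
    exact Finset.sum_nonneg fun i _ => mul_self_nonneg _
  · simp only [LinearMap.smul_apply, smul_eq_mul, tensorSq_apply]
    have := mul_self_nonneg (wedge (α 1) (α 2) t)
    positivity

/-- A form in `W` that vanishes on the kernel of a tensor of the third family is determined by its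
values `Bᵢⱼ` on `b₀ ∨ bᵢ`, and the symmetry of `W` forces `B` to be a multiple of the identity. -/
lemma isExtremal_netForm {α : Fin 3 → Module.Dual ℝ V}
    (hα : ∀ i j, α i (b j) = if i = j then 1 else 0) {g d h : ℝ}
    (hκ : 0 < g ^ 2 + d ^ 2 - 1 - d * h) :
    IsExtremal (CW V) (liftForm (netForm α g d h)) := by
  have hH := isSymForm_netForm α g d h
  have hb := isAdapted_netForm (b := b) hα g d h
  have hdiag : ∀ j t, netForm α g d h (b 0 ⊗ₜ b j) t = net α g d h j t := by
    intro j t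
    rw [netForm_apply]
    fin_cases j <;> simp [Fin.sum_univ_three, net_zero_tmul, net_one_tmul, net_two_tmul, hα]
  refine isExtremal_of_forall (M := W V) (fun T => Iff.rfl) (fun T hT => hT.1)
    (netForm_mem_CW hκ) (fun h0 => ?_) fun T hT hk => ?_
  · have h1 := hH.symPart_liftForm
    rw [h0] at h1
    have h2 := hb.orthonormal 0 0
    rw [← h1, symPart_tmul] at h2
    simp at h2
  · set K := symPart T with hKdef
    have hK : IsSymForm K := isSymForm_symPart hT
    have hTK : liftForm K = T := liftForm_symPart hT
    have hker : ∀ t, netForm α g d h t = 0 → K t = 0 := by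
      intro t ht
      have h1 : T (t + TensorProduct.comm ℝ V V t) = 0 := hk _ (by
        rw [liftForm, LinearMap.add_apply, map_add, map_add, hH.comm_left, hH.altForm_comm, ht]
        simp)
      refine LinearMap.ext fun s => ?_
      rw [hK.apply_eq_liftForm, hTK, h1]
      simp
    have halt : ∀ x, altForm K (b 0 ⊗ₜ x) = 0 := by
      intro x
      have h1 : T (b 0 ⊗ₜ x - x ⊗ₜ b 0) = 0 := hk _ (by
        rw [liftForm, LinearMap.add_apply, map_sub, map_sub, hH.2 x, hH.altForm_swap x,
          hb.alternating]
        simp)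
      refine LinearMap.ext fun s => ?_
      rw [hK.altForm_apply_eq_liftForm, hTK, TensorProduct.comm_tmul, h1]
      simp
    have hK1 : ∀ t, K t = ∑ i, net α g d h i t • K (b 0 ⊗ₜ b i) := by
      intro t
      have h1 := hker (t - ∑ i, net α g d h i t • (b 0 ⊗ₜ b i)) (by
        refine LinearMap.ext fun s => ?_
        rw [map_sub, map_sum]
        simp only [map_smul, LinearMap.sub_apply, LinearMap.sum_apply, LinearMap.smul_apply,
          hdiag, netForm_apply, smul_eq_mul, sub_self, LinearMap.zero_apply])
      rw [map_sub, map_sum, sub_eq_zero] at h1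
      rw [h1]
      simp only [map_smul]
    obtain ⟨B, hB⟩ : ∃ B : Fin 3 → Fin 3 → ℝ, ∀ i j, K (b 0 ⊗ₜ b i) (b 0 ⊗ₜ b j) = B i j :=
      ⟨_, fun _ _ => rfl⟩
    have hBs : ∀ i j, B i j = B j i := fun i j => by rw [← hB, hK.1, hB]
    have hK2 : ∀ i t, K (b 0 ⊗ₜ b i) t = ∑ j, net α g d h j t * B i j := by
      intro i t
      rw [hK.1, hK1]
      simp only [LinearMap.sum_apply, LinearMap.smul_apply, smul_eq_mul, hB, hBs i]
    have rel := fun x y z => apply_swap_of_altForm_eq_zero (halt x) y z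
    -- the total symmetry of `T` with one argument equal to `b₀`, written in terms of `B`
    have e1 := rel (b 1) (b 1) (b 0)
    have e2 := rel (b 1) (b 2) (b 0)
    have e3 := rel (b 2) (b 2) (b 0)
    have e4 := rel (b 1) (b 2) (b 1)
    have e5 := rel (b 2) (b 2) (b 1)
    simp only [hK2, Fin.sum_univ_three, net_zero_tmul, net_one_tmul, net_two_tmul, hα,
      Fin.isValue, Fin.reduceEq, if_true, if_false, mul_one, one_mul, mul_zero, zero_mul, add_zero,
      zero_add, hBs 1 0, hBs 2 0, hBs 2 1] at e1 e2 e3 e4 e5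
    have hB02 : B 0 2 = 0 := by
      have : (g ^ 2 + d ^ 2 - 1 - d * h) * B 0 2 = 0 := by
        linear_combination d * e1 + g * e2 - d * e3 + e4
      exact (mul_eq_zero.1 this).resolve_left hκ.ne'
    have hB01 : B 0 1 = 0 := by
      have : (g ^ 2 + d ^ 2 - 1 - d * h) * B 0 1 = 0 := by
        linear_combination -e5 - g * e1 - (h - d) * e2 + g * e3
      exact (mul_eq_zero.1 this).resolve_left hκ.ne'
    rw [hB02] at e1
    rw [hB01, hB02] at e2 e3
    have hKH : K = B 0 0 • netForm α g d h := by
      refine LinearMap.ext fun s => LinearMap.ext fun t => ?_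
      rw [hK1, LinearMap.smul_apply, LinearMap.smul_apply, netForm_apply]
      simp only [LinearMap.add_apply, LinearMap.smul_apply, smul_eq_mul, hK2, Fin.sum_univ_three,
        hBs 1 0, hBs 2 0, hBs 2 1, hB01, hB02]
      linear_combination (-(net α g d h 1 s * net α g d h 1 t)) * e1 -
        (net α g d h 1 s * net α g d h 2 t + net α g d h 2 s * net α g d h 1 t) * e2 -
        (net α g d h 2 s * net α g d h 2 t) * e3
    refine ⟨B 0 0, ?_⟩
    rw [← hTK, hKH, liftForm, liftForm, altForm_smul, smul_add]

end Adapted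

/-! ### Construction and normalisation of adapted bases -/

section Normalisation

variable {V : Type*} [AddCommGroup V] [Module ℝ V]
variable {H : LinearMap.BilinForm ℝ (V ⊗[ℝ] V)}

/-- As many orthonormal vectors as the rank of `H` give an expansion of `H`. -/
lemma expansion_of_orthonormal {E : Type*} [AddCommGroup E] [Module ℝ E]
    {H : LinearMap.BilinForm ℝ E} {n : ℕ} {v u : Fin n → E}
    (he : ∀ x y, H x y = ∑ i, H x (v i) * H y (v i))
    (hu : ∀ i j, H (u i) (u j) = if i = j then 1 else 0) (s t : E) :
    H s t = ∑ i, H s (u i) * H t (u i) := by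
  classical
  let M : Matrix (Fin n) (Fin n) ℝ := Matrix.of fun m i => H (u m) (v i)
  have hM : M * M.transpose = 1 := by
    ext m k
    rw [Matrix.mul_apply, Matrix.one_apply, ← hu, he]
    rfl
  have hM' := mul_eq_one_comm.1 hM
  have h1 : ∀ s m, H s (u m) = ∑ i, H s (v i) * M m i := fun s m => he s (u m)
  let a : Fin n → ℝ := fun i => H s (v i)
  let c : Fin n → ℝ := fun i => H t (v i)
  have h2 : ∑ m, H s (u m) * H t (u m) = (M.mulVec a) ⬝ᵥ (M.mulVec c) := by
    simp only [h1, dotProduct, Matrix.mulVec]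
    refine Finset.sum_congr rfl fun m _ => ?_
    simp only [a, c, mul_comm]
  rw [h2, Matrix.dotProduct_mulVec, Matrix.vecMul_mulVec, hM', Matrix.vecMul_one]
  exact he s t

lemma exists_basis_of_orthonormal (hV : Module.finrank ℝ V = 3) {z : V} {u : Fin 3 → V}
    (hu : ∀ i j, H (z ⊗ₜ u i) (z ⊗ₜ u j) = if i = j then 1 else 0) :
    ∃ b : Module.Basis (Fin 3) ℝ V, ∀ i, b i = u i := by
  have hli : LinearIndependent ℝ u := by
    rw [Fintype.linearIndependent_iff]
    intro c hc j
    have h1 := congrArg (fun x => H (z ⊗ₜ x) (z ⊗ₜ u j)) hc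
    simp only [TensorProduct.tmul_sum, TensorProduct.tmul_smul, map_sum, map_smul,
      LinearMap.sum_apply, LinearMap.smul_apply, hu, smul_eq_mul, TensorProduct.tmul_zero,
      map_zero, LinearMap.zero_apply] at h1
    simpa using h1
  refine ⟨basisOfLinearIndependentOfCardEqFinrank hli (by simp [hV]), fun i => ?_⟩
  rw [coe_basisOfLinearIndependentOfCardEqFinrank]

/-- If `H` has rank three and is nondegenerate on `z ∨ V`, orthonormalisation in `z ∨ V` yields an
adapted basis whose first vector is a multiple of `z`. -/
lemma IsSymForm.exists_isAdapted (hV : Module.finrank ℝ V = 3) (hH : IsSymForm H)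
    (hp : ∀ t, 0 ≤ H t t) {v : Fin 3 → V ⊗[ℝ] V}
    (he : ∀ x y, H x y = ∑ i, H x (v i) * H y (v i)) {z : V} (hz0 : z ≠ 0)
    (hz : ∀ x, altForm H (z ⊗ₜ x) = 0) (hinj : ∀ x, H (z ⊗ₜ x) = 0 → x = 0) :
    ∃ b : Module.Basis (Fin 3) ℝ V, IsAdapted H b := by
  have hpos : ∀ x, x ≠ 0 → 0 < H (z ⊗ₜ x) (z ⊗ₜ x) := fun x hx =>
    lt_of_le_of_ne (hp _) fun h => hx (hinj x (apply_eq_zero_of_self hH.1 hp h.symm))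
  -- scaling of the first vector by the inverse of a fourth root
  obtain ⟨r, hr0, hr⟩ : ∃ r : ℝ, r ≠ 0 ∧ r * r * (r * r) * H (z ⊗ₜ z) (z ⊗ₜ z) = 1 := by
    have hm := hpos z hz0
    have h1 := Real.sqrt_pos.2 hm
    have h2 := Real.sqrt_pos.2 h1
    refine ⟨(Real.sqrt (Real.sqrt (H (z ⊗ₜ z) (z ⊗ₜ z))))⁻¹, inv_ne_zero h2.ne', ?_⟩
    rw [← mul_inv, Real.mul_self_sqrt h1.le, ← mul_inv, Real.mul_self_sqrt hm.le,
      inv_mul_cancel₀ hm.ne']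
  set e := r • z with he0
  have hene : e ≠ 0 := smul_ne_zero hr0 hz0
  let G : LinearMap.BilinForm ℝ V := H.compl₁₂ (TensorProduct.mk ℝ V V e) (TensorProduct.mk ℝ V V e)
  have hG : ∀ x y, G x y = H (e ⊗ₜ x) (e ⊗ₜ y) := fun x y => rfl
  have hGs : ∀ x y, G x y = G y x := fun x y => hH.1 _ _
  have hGpos : ∀ x, x ≠ 0 → 0 < G x x := by
    intro x hx
    rw [hG, he0, ← TensorProduct.smul_tmul', map_smul, map_smul, LinearMap.smul_apply, smul_eq_mul,
      smul_eq_mul, ← mul_assoc]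
    exact mul_pos (mul_self_pos.2 hr0) (hpos x hx)
  have hGe : G e e = 1 := by
    rw [hG, he0, ← hr]
    simp only [← TensorProduct.smul_tmul', TensorProduct.tmul_smul, map_smul,
      LinearMap.smul_apply, smul_eq_mul]
    ring
  have hnorm : ∀ x, x ≠ 0 → ∃ c : ℝ, c ≠ 0 ∧ G (c • x) (c • x) = 1 := by
    intro x hx
    have h1 := hGpos x hx
    refine ⟨(Real.sqrt (G x x))⁻¹, inv_ne_zero (Real.sqrt_pos.2 h1).ne', ?_⟩
    rw [map_smul, map_smul, LinearMap.smul_apply, smul_eq_mul, smul_eq_mul, ← mul_assoc, ← mul_inv,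
      Real.mul_self_sqrt h1.le, inv_mul_cancel₀ h1.ne']
  obtain ⟨b, hb⟩ := exists_basis_of_ne_zero hV hene
  have hli := Fintype.linearIndependent_iff.1 b.linearIndependent
  -- Gram-Schmidt
  obtain ⟨c₁, hc₁, h11⟩ := hnorm (b 1 - G (b 1) e • e) fun h => by
    have := hli ![-G (b 1) e, 1, 0] (by
      simp only [Fin.sum_univ_three, Matrix.cons_val, hb, ← h]; module) 1
    simp at this
  set f := c₁ • (b 1 - G (b 1) e • e) with hf
  have h01 : G f e = 0 := by
    simp only [hf, map_smul, map_sub, LinearMap.smul_apply, LinearMap.sub_apply, smul_eq_mul, hGe]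
    ring
  obtain ⟨c₂, hc₂, h22⟩ := hnorm (b 2 - G (b 2) e • e - G (b 2) f • f) fun h => by
    have := hli ![-G (b 2) e + G (b 2) f * c₁ * G (b 1) e, -G (b 2) f * c₁, 1] (by
      simp only [Fin.sum_univ_three, Matrix.cons_val, hb]
      rw [← h, hf]
      module) 2
    simp at this
  set k := c₂ • (b 2 - G (b 2) e • e - G (b 2) f • f) with hk
  have h02 : G k e = 0 := by
    simp only [hk, map_smul, map_sub, LinearMap.smul_apply, LinearMap.sub_apply, smul_eq_mul, hGe,
      h01]
    ring
  have h12 : G k f = 0 := by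
    simp only [hk, map_smul, map_sub, LinearMap.smul_apply, LinearMap.sub_apply, smul_eq_mul, h11,
      hGs e f, h01]
    ring
  have hu : ∀ i j, H (e ⊗ₜ ![e, f, k] i) (e ⊗ₜ ![e, f, k] j) = if i = j then 1 else 0 := by
    intro i j
    rw [← hG]
    fin_cases i <;> fin_cases j <;>
    simp [hGe, h11, h22, h01, h02, h12, hGs e f, hGs e k, hGs f k]
  obtain ⟨b', hb'⟩ := exists_basis_of_orthonormal hV hu
  have hb0 : b' 0 = e := hb' 0
  have ho : ∀ i j, H (b' 0 ⊗ₜ b' i) (b' 0 ⊗ₜ b' j) = if i = j then 1 else 0 := by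
    intro i j
    rw [hb0, hb' i, hb' j, hu]
  refine ⟨b', ho, expansion_of_orthonormal he ho, fun x => ?_⟩
  rw [hb0, he0, ← TensorProduct.smul_tmul', map_smul, hz, smul_zero]

/-- A binary cubic form has a real zero on the unit circle. -/
lemma exists_cubic_zero (a b c d : ℝ) : ∃ x y : ℝ, x ^ 2 + y ^ 2 = 1 ∧
    a * x ^ 3 + b * x ^ 2 * y + c * x * y ^ 2 + d * y ^ 3 = 0 := by
  let f : ℝ → ℝ := fun θ => a * Real.cos θ ^ 3 + b * Real.cos θ ^ 2 * Real.sin θ +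
    c * Real.cos θ * Real.sin θ ^ 2 + d * Real.sin θ ^ 3
  have hf : Continuous f := by fun_prop
  have h0 : f 0 = a := by simp [f]
  have h1 : f Real.pi = -a := by simp [f]; ring
  obtain ⟨θ, hθ⟩ : ∃ θ, f θ = 0 := by
    rcases le_total a 0 with ha | ha
    · exact mem_range_of_exists_le_of_exists_ge hf ⟨0, by rw [h0]; exact ha⟩
        ⟨Real.pi, by rw [h1]; linarith⟩
    · exact mem_range_of_exists_le_of_exists_ge hf ⟨Real.pi, by rw [h1]; linarith⟩
        ⟨0, by rw [h0]; exact ha⟩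
  exact ⟨Real.cos θ, Real.sin θ, Real.cos_sq_add_sin_sq θ, hθ⟩

/-- A rotation in the plane of `b₁` and `b₂` makes the coefficient of `b₁³` in the cubic form
`H (b₀ ∨ x, x ∨ x)` vanish. -/
lemma IsAdapted.exists_rotation (hV : Module.finrank ℝ V = 3) (hH : IsSymForm H)
    {b : Module.Basis (Fin 3) ℝ V} (hb : IsAdapted H b) :
    ∃ b' : Module.Basis (Fin 3) ℝ V, IsAdapted H b' ∧ H (b' 0 ⊗ₜ b' 1) (b' 1 ⊗ₜ b' 1) = 0 := by
  obtain ⟨x, y, hxy, h0⟩ := exists_cubic_zero (H (b 0 ⊗ₜ b 1) (b 1 ⊗ₜ b 1))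
    (3 * H (b 0 ⊗ₜ b 2) (b 1 ⊗ₜ b 1)) (3 * H (b 0 ⊗ₜ b 2) (b 1 ⊗ₜ b 2))
    (H (b 0 ⊗ₜ b 2) (b 2 ⊗ₜ b 2))
  have hu : ∀ i j, H (b 0 ⊗ₜ ![b 0, x • b 1 + y • b 2, (-y) • b 1 + x • b 2] i)
      (b 0 ⊗ₜ ![b 0, x • b 1 + y • b 2, (-y) • b 1 + x • b 2] j) = if i = j then 1 else 0 := by
    have ho := hb.orthonormal
    intro i j
    fin_cases i <;> fin_cases j <;>
    simp [TensorProduct.tmul_add, TensorProduct.tmul_smul, TensorProduct.tmul_neg, ho] <;>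
    linarith
  obtain ⟨b', hb'⟩ := exists_basis_of_orthonormal hV hu
  have hb0 : b' 0 = b 0 := hb' 0
  have hb1 : b' 1 = x • b 1 + y • b 2 := hb' 1
  have ho : ∀ i j, H (b' 0 ⊗ₜ b' i) (b' 0 ⊗ₜ b' j) = if i = j then 1 else 0 := by
    intro i j
    rw [hb0, hb' i, hb' j, hu]
  refine ⟨b', ⟨ho, expansion_of_orthonormal hb.expansion ho, fun t => ?_⟩, ?_⟩
  · rw [hb0, hb.alternating]
  · rw [hb0, hb1, ← h0]
    simp only [TensorProduct.tmul_add, TensorProduct.add_tmul, TensorProduct.tmul_smul,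
      ← TensorProduct.smul_tmul', map_add, map_smul, LinearMap.add_apply, LinearMap.smul_apply,
      smul_eq_mul, hH.swap_right _ (b 2) (b 1)]
    rw [hb.apply_swap (b 1) (b 1) (b 2), hb.apply_swap (b 1) (b 2) (b 2),
      hH.swap_right _ (b 2) (b 1)]
    ring

lemma IsAdapted.isType3 (hV : Module.finrank ℝ V = 3) (hH : IsSymForm H)
    {b : Module.Basis (Fin 3) ℝ V} (hb : IsAdapted H b) (ha : ∀ t, 0 ≤ altForm H t t)
    (hne : altForm H ≠ 0) : IsType3 (liftForm H) := by
  obtain ⟨b, hb, h111⟩ := hb.exists_rotation hV hH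
  let g := H (b 0 ⊗ₜ b 2) (b 1 ⊗ₜ b 2)
  let d := H (b 0 ⊗ₜ b 2) (b 1 ⊗ₜ b 1)
  let h := H (b 0 ⊗ₜ b 2) (b 2 ⊗ₜ b 2)
  have hα : ∀ i j, b.dualBasis i (b j) = if i = j then 1 else 0 := by
    intro i j
    rw [Module.Basis.dualBasis_apply_self]
    simp only [eq_comm]
  have hnet : ∀ m, H (b 0 ⊗ₜ b m) = net b.dualBasis g d h m := by
    intro m
    refine (b.tensorProduct b).ext fun ⟨i, j⟩ => ?_
    have ho := hb.orthonormal
    have h00 : ∀ i j, H (b 0 ⊗ₜ b 0) (b i ⊗ₜ b j) = if i = j then 1 else 0 := fun i j => by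
      rw [hb.apply_swap, hH.swap_right, ho]
      simp only [eq_comm]
    have hs : ∀ m i, H (b 0 ⊗ₜ b m) (b i ⊗ₜ b 0) = if m = i then 1 else 0 := fun m i => by
      rw [hH.swap_right, ho]
    have h112 : H (b 0 ⊗ₜ b 1) (b 1 ⊗ₜ b 2) = d := hb.apply_swap _ _ _
    have h122 : H (b 0 ⊗ₜ b 1) (b 2 ⊗ₜ b 2) = g := by
      rw [hb.apply_swap, hH.swap_right]
    rw [Module.Basis.tensorProduct_apply]
    fin_cases m <;> fin_cases i <;> fin_cases j <;>
    simp [net_zero_tmul, net_one_tmul, net_two_tmul, hα, h00, hs, ho, h111, h112, h122,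
      hH.swap_right _ (b 2) (b 1), g, d, h, -Module.Basis.coe_dualBasis]
  have hHnet : H = netForm b.dualBasis g d h := by
    refine LinearMap.ext fun s => LinearMap.ext fun t => ?_
    rw [hb.expansion, netForm_apply]
    refine Finset.sum_congr rfl fun i _ => ?_
    rw [hH.1 s, hH.1 t, hnet]
  have hκ : 0 < g ^ 2 + d ^ 2 - 1 - d * h := by
    have h1 : altForm H (b 1 ⊗ₜ b 2) (b 1 ⊗ₜ b 2) = g ^ 2 + d ^ 2 - 1 - d * h := by
      rw [hHnet, altForm_netForm]
      simp [tensorSq_apply, wedge_tmul, hα, -Module.Basis.coe_dualBasis]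
      ring
    rw [← h1]
    exact lt_of_le_of_ne (ha _) fun h => hne (hb.altForm_eq_zero hH h.symm)
  exact isType3_iff.2 ⟨b.dualBasis, g, d, h, hκ, by rw [hHnet]⟩

/-- When the alternating block vanishes, the products `x ∘ y` defined by
`H (b₀ ∨ (x ∘ y), b₀ ∨ w) = H (x ∨ y, b₀ ∨ w)` form an associative algebra, and multiplication by
`b₁` gives a totally symmetric form which vanishes on the kernel of `H`. -/
lemma IsAdapted.altForm_ne_zero [FiniteDimensional ℝ V] (hH : IsSymForm H)
    (hext : IsExtremal (CW V) (liftForm H)) {b : Module.Basis (Fin 3) ℝ V} (hb : IsAdapted H b) :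
    altForm H ≠ 0 := by
  intro h0
  have tot : ∀ x y z w, H (x ⊗ₜ y) (z ⊗ₜ w) = H (x ⊗ₜ w) (z ⊗ₜ y) := fun x y z w =>
    apply_swap_of_altForm_eq_zero (by rw [h0, LinearMap.zero_apply]) _ _
  let a : Fin 3 → Fin 3 → ℝ := fun m n => H (b 0 ⊗ₜ b m) (b 1 ⊗ₜ b n)
  have ha : ∀ m n, a m n = a n m := fun m n => tot _ _ _ _
  set K := spanForm H (fun m => b 0 ⊗ₜ[ℝ] b m) a with hKdef
  have hK : IsSymForm K := hH.spanForm _ ha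
  have hK1 : ∀ s t, K s t = ∑ m, H s (b 0 ⊗ₜ b m) * H (b 1 ⊗ₜ b m) t := by
    intro s t
    rw [hKdef, spanForm_apply]
    refine Finset.sum_congr rfl fun m _ => ?_
    rw [hb.expansion (b 1 ⊗ₜ b m) t, Finset.mul_sum]
    refine Finset.sum_congr rfl fun n _ => ?_
    have e : H (b 1 ⊗ₜ b m) (b 0 ⊗ₜ b n) = a m n := by
      rw [hH.1]
      exact ha n m
    rw [hH.1 s, hH.1 t, e]
    ring
  have hK2 : ∀ x y z w, K (x ⊗ₜ w) (y ⊗ₜ z) =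
      ∑ m, H (b 1 ⊗ₜ x) (b 0 ⊗ₜ b m) * H (b m ⊗ₜ w) (y ⊗ₜ z) := by
    intro x y z w
    have e1 : ∀ n, H (x ⊗ₜ w) (b 1 ⊗ₜ b n) =
        ∑ m, H (b 1 ⊗ₜ x) (b 0 ⊗ₜ b m) * H (b 0 ⊗ₜ b n) (b m ⊗ₜ w) := by
      intro n
      rw [hH.swap_right, tot, hH.2 x, hb.expansion]
      refine Finset.sum_congr rfl fun m _ => ?_
      have e : H (b n ⊗ₜ w) (b 0 ⊗ₜ b m) = H (b 0 ⊗ₜ b n) (b m ⊗ₜ w) := by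
        rw [hH.1, hH.swap_right, tot, hH.swap_right]
      rw [e]
    rw [hK.1, hK1]
    simp only [hH.1 _ (x ⊗ₜ w), e1, Finset.mul_sum]
    rw [Finset.sum_comm]
    refine Finset.sum_congr rfl fun m _ => ?_
    rw [hb.expansion (b m ⊗ₜ w), Finset.mul_sum]
    refine Finset.sum_congr rfl fun n _ => ?_
    rw [hH.1 (b 0 ⊗ₜ b n)]
    ring
  have haK : altForm K = 0 := by
    refine form_ext fun x y z w => ?_
    rw [altForm_tmul, hK2, hK2, LinearMap.zero_apply, LinearMap.zero_apply, sub_eq_zero]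
    exact Finset.sum_congr rfl fun m _ => by rw [tot (b m) w y z]
  obtain ⟨c, hc⟩ := hH.exists_smul_eq hext hK
    (fun t => spanForm_eq_zero_of_apply_eq_zero hH _ _) (fun t _ => by rw [haK]; rfl)
  have h1 := LinearMap.congr_fun (LinearMap.congr_fun hc (b 0 ⊗ₜ b 0)) (b 0 ⊗ₜ b 1)
  rw [hK1, LinearMap.smul_apply, LinearMap.smul_apply, hb.orthonormal] at h1
  simp only [hb.orthonormal, Fin.sum_univ_three] at h1
  rw [hH.2 (b 1) (b 0), hb.orthonormal] at h1
  simp at h1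

end Normalisation

/-! ### The classification -/

section Classification

variable {V : Type*} [AddCommGroup V] [Module ℝ V]

lemma IsExtremal.isType (hV : Module.finrank ℝ V = 3)
    {S : LinearMap.BilinForm ℝ (V ⊗[ℝ] V)} (hext : IsExtremal (CW V) S) :
    IsType1 S ∨ IsType2 S ∨ IsType3 S := by
  have : FiniteDimensional ℝ V := Module.finite_of_finrank_pos (by omega)
  have hH := isSymForm_symPart hext.1.1
  have hS := liftForm_symPart hext.1.1
  generalize symPart S = H at hH hS
  subst hS
  obtain ⟨hp, ha⟩ := hH.liftForm_mem_CW_iff.1 hext.1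
  obtain ⟨n, v, hv, he⟩ := exists_orthonormal_expansion hH.1 hp
  rcases Nat.lt_or_ge n 2 with hn | hn
  · interval_cases n
    · have h0 : H = 0 := LinearMap.ext fun s => LinearMap.ext fun t => by
        rw [he]; simp
      refine absurd ?_ hext.2.1
      rw [h0]
      exact form_ext fun x y z w => by simp [liftForm_tmul]
    · have h := hH.isType1_or_isType2 hV ha hext.2.1 (v := v 0) (fun s t => by
        rw [he, Fin.sum_univ_one])
      tauto
  · obtain ⟨z, hz0, hz⟩ := hH.exists_forall_altForm_eq_zero hext hv hV hn he
    have hinj : ∀ x, H (z ⊗ₜ x) = 0 → x = 0 := fun x hx =>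
      hH.eq_zero_of_apply_tmul_eq_zero hV hext hv hn hz0 hz hx
    have h3 : n = 3 := by
      refine le_antisymm (hH.rank_le_three hext hv (Module.finBasisOfFinrankEq ℝ V hV)) ?_
      let f : V →ₗ[ℝ] (Fin n → ℝ) := LinearMap.pi fun i =>
        (LinearMap.BilinForm.flip H (v i)) ∘ₗ TensorProduct.mk ℝ V V z
      have hf : ∀ x i, f x i = H (z ⊗ₜ x) (v i) := fun x i => rfl
      have hfi : Function.Injective f := by
        rw [injective_iff_map_eq_zero]
        intro x hx
        refine hinj x (LinearMap.ext fun t => ?_)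
        rw [he, LinearMap.zero_apply]
        exact Finset.sum_eq_zero fun i _ => by rw [← hf, hx]; simp
      have := LinearMap.finrank_le_finrank_of_injective hfi
      simpa [hV] using this
    subst h3
    obtain ⟨b, hb⟩ := hH.exists_isAdapted hV hp he hz0 hz hinj
    exact Or.inr (Or.inr (hb.isType3 hV hH ha (hb.altForm_ne_zero hH hext)))

lemma IsType3.isExtremal_and_hasInelasticRanks (hV : Module.finrank ℝ V = 3)
    {S : LinearMap.BilinForm ℝ (V ⊗[ℝ] V)} (h : IsType3 S) :
    IsExtremal (CW V) S ∧ HasInelasticRanks S := by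
  have : FiniteDimensional ℝ V := Module.finite_of_finrank_pos (by omega)
  obtain ⟨α, g, d, k, hκ, rfl⟩ := isType3_iff.1 h
  obtain ⟨b, hb⟩ := exists_dual_basis α
  refine ⟨isExtremal_netForm hb hκ, (isAdapted_netForm hb g d k).hasInelasticRanks
    (isSymForm_netForm _ _ _ _) ?_⟩
  have e : altForm (netForm α g d k) (b 1 ⊗ₜ b 2) (b 1 ⊗ₜ b 2) = g ^ 2 + d ^ 2 - 1 - d * k := by
    rw [altForm_netForm]
    simp [tensorSq_apply, wedge_tmul, hb]
    ring
  rw [e]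
  exact hκ

/-- Condition `(∗)` says that `H` has rank three and is nondegenerate on `z ∨ V`, and that the
alternating block is nonzero with kernel `z ∧ V`. -/
lemma HasInelasticRanks.isType3 (hV : Module.finrank ℝ V = 3)
    {S : LinearMap.BilinForm ℝ (V ⊗[ℝ] V)} (hS : S ∈ CW V) (h : HasInelasticRanks S) :
    IsType3 S := by
  have : FiniteDimensional ℝ V := Module.finite_of_finrank_pos (by omega)
  have hH := isSymForm_symPart hS.1
  have hSH := liftForm_symPart hS.1
  generalize symPart S = H at hH hSH
  subst hSH
  obtain ⟨hp, ha⟩ := hH.liftForm_mem_CW_iff.1 hS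
  obtain ⟨h1, h2, z, hz0, hker, hint⟩ := h
  obtain ⟨n, v, hv, he⟩ := exists_orthonormal_expansion hH.1 hp
  rw [hH.formRank_R_liftForm hv he] at h2
  subst h2
  have hz : ∀ x, altForm H (z ⊗ₜ x) = 0 := by
    intro x
    have hmem : (1 / 2 : ℝ) • (z ⊗ₜ[ℝ] x - x ⊗ₜ[ℝ] z) ∈ wedgeSpace z := ⟨x, rfl⟩
    rw [← hker] at hmem
    obtain ⟨s, hs, hs'⟩ := hmem
    refine apply_eq_zero_of_self hH.altForm_symm ha ?_
    have h3 := LinearMap.congr_fun (LinearMap.mem_ker.1 hs) s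
    rw [hH.R'_liftForm_apply, show (s : V ⊗[ℝ] V) = _ from hs'] at h3
    simp only [map_smul, map_sub, hH.altForm_swap x z, hH.altForm_swap_right _ x z,
      LinearMap.smul_apply, LinearMap.sub_apply, LinearMap.neg_apply, smul_eq_mul,
      LinearMap.zero_apply] at h3
    linarith
  have hinj : ∀ x, H (z ⊗ₜ x) = 0 → x = 0 := by
    intro x hx
    have hmem : (1 / 2 : ℝ) • (z ⊗ₜ[ℝ] x + x ⊗ₜ[ℝ] z) ∈
        LinearMap.ker (liftForm H) ⊓ veeSpace z := by
      refine ⟨?_, x, rfl⟩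
      rw [SetLike.mem_coe, LinearMap.mem_ker, liftForm, LinearMap.add_apply]
      simp only [map_smul, map_add, hH.altForm_swap x z, hH.2 x z, hx, hz]
      simp
    rw [hint, Submodule.mem_bot] at hmem
    exact tmul_add_tmul_eq_zero hz0 ((smul_eq_zero.1 hmem).resolve_left (by norm_num))
  obtain ⟨b, hb⟩ := hH.exists_isAdapted hV hp he hz0 hz hinj
  refine hb.isType3 hV hH ha fun h0 => ?_
  have hR' : R' (liftForm H) = 0 := LinearMap.ext fun s => LinearMap.ext fun t => by
    rw [hH.R'_liftForm_apply, h0]; rfl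
  rw [hR', formRank, LinearMap.ker_zero, finrank_top, Nat.sub_self] at h1
  exact absurd h1 (by norm_num)

end Classification

end PositivityCone

theorem mainTheorem1 {V : Type*} [AddCommGroup V] [Module ℝ V] (hV : Module.finrank ℝ V = 3) :
    (∀ S : LinearMap.BilinForm ℝ (V ⊗[ℝ] V),
      PositivityCone.IsExtremal (PositivityCone.CW V) S ↔
        PositivityCone.IsType1 S ∨ PositivityCone.IsType2 S ∨ PositivityCone.IsType3 S) ∧
    (∀ S : LinearMap.BilinForm ℝ (V ⊗[ℝ] V),
      PositivityCone.IsType3 S ↔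
        PositivityCone.IsExtremal (PositivityCone.CW V) S ∧
          PositivityCone.HasInelasticRanks S) ∧
    (∀ S ∈ PositivityCone.CW V, S ≠ 0 →
      ¬ PositivityCone.IsExtremal (PositivityCone.CSym V) (PositivityCone.R S) →
        (PositivityCone.IsExtremal (PositivityCone.CW V) S ↔
          PositivityCone.HasInelasticRanks S)) := by
  refine ⟨fun S => ⟨fun h => h.isType hV, ?_⟩, fun S => ⟨fun h =>
    h.isExtremal_and_hasInelasticRanks hV, fun h => h.2.isType3 hV h.1.1⟩, fun S hS _ hR =>
    ⟨fun h => ?_, fun h => ((h.isType3 hV hS).isExtremal_and_hasInelasticRanks hV).1⟩⟩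
  · rintro (h | h | h)
    · exact h.isExtremal
    · exact h.isExtremal hV
    · exact (h.isExtremal_and_hasInelasticRanks hV).1
  · rcases h.isType hV with h | h | h
    · exact absurd h.isExtremal_R hR
    · exact absurd (h.isExtremal_R hV) hR
    · exact (h.isExtremal_and_hasInelasticRanks hV).2
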